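/- **Setting.** Let $X=\{x_1,\dots,x_n\}$, let $>$ be a degree ordering on the monomials of $X$ (a global monomial ordering with $X^\alpha>X^\beta$ whenever $|\alpha|>|\beta|$), let $\sigma\in S_n$ have order $k$ and act on polynomials by $x_i\mapsto x_{\sigma(i)}$, and let $I=\langle F\rangle\subseteq\mathbb Q[X]$, $F$ finite, be an ideal with $\sigma(I)=I$. For an ideal $J$ write $\mathrm{std}(J)$ for its reduced Gröbner basis, and $\mathrm{LM}$ for leading monomials. For a prime $p$ dividing no denominator of $F$ let $I_p=\langle F \bmod p\rangle\subseteq\mathbb F_p[X]$. More generally, $p$ is *lucky* for $\langle H\rangle$ ($H$ a finite set of rational polynomials, $p$ dividing no denominator of $H$) if $\mathrm{LM}(\mathrm{std}\langle H\rangle)=\mathrm{LM}(\mathrm{std}\langle H\bmod p\rangle)$. **symmStd.** Over a field $K$ with $\operatorname{char}K\nmid k$ and a primitive $k$-th root of unity $\xi\in K$, take a cycle decomposition of $\sigma$, with cycles $(e_{1}\,\dots\,e_{l})$, and let $\tau$ be the automorphism of $K[X]$ with $\tau(x_{e_i})=\sum_{j=1}^{l}\xi^{(k/l)(i-1)(j-1)}x_{\sigma^{j-1}(e_i)}$.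 Then $\mathrm{symmStd}(J,\sigma)=\mathrm{std}\langle\tau^{-1}(\mathrm{std}(\tau(J)))\rangle$. **syModStd.** Choose a finite set $P$ of primes $p$ with $k\mid p-1$, dividing no denominator of $F$. Then repeat the following round. 1. For $p\in P$ compute $G_p=\mathrm{symmStd}(I_p,\sigma)$, using any primitive $k$-th root of unity in $\mathbb F_p$ and any cycle decomposition of $\sigma$. 2. (deleteUnluckyPrimesSB) Replace $P$ by a largest class (any one, in case of a tie) of the equivalence relation $\mathrm{LM}(G_p)=\mathrm{LM}(G_q)$. 3. (Lifting) Put $N=\prod_{p\in P}p$. Combine the elements of the $G_p$ having the same leading monomial, coefficient by coefficient: compute the residue $a$ modulo $N$ by the Chinese remainder algorithm, then replace it by the fraction $r/s$ in lowest terms with $|r|,s\le\sqrt{(N-1)/2}$, $\gcd(s,N)=1$ and $r\equiv as \pmod N$ (Farey rational map). If all these fractions exist, the result is a candidate $G\subseteq\mathbb Q[X]$. 4. (finalVerificationTests) If there is a candidate $G$, choose a prime $p\notin P$ dividing no numerator or denominator of a nonzero coefficient of $F$ or $G$, and test that (i) $G \bmod p$ is a Gröbner basis of $I_p$; (ii)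 $F\subseteq\langle G\rangle$; (iii) $G$ is a Gröbner basis of $\langle G\rangle$; (iv) $p$ is lucky for $\langle F^h\cup\{t^m\}\rangle$ with respect to $>_h$. Here $F^h$ is the set of homogenizations of the elements of $F$ with respect to a new variable $t$; $X^\alpha t^a>_hX^\beta t^b$ means $|\alpha|+a>|\beta|+b$, or $|\alpha|+a=|\beta|+b$ and $X^\alpha>X^\beta$; and $m$ is any integer with $(\langle F^h \bmod p\rangle:t^m)=(\langle F^h \bmod p\rangle:t^\infty)$. If all tests are passed, return $G$ and stop. 5. Otherwise enlarge $P$ by further primes $p$ with $k\mid p-1$ dividing no denominator of $F$. Call a prime $p$ dividing no denominator of $F$ *misleading* if $p$ is lucky for $I=\langle F\rangle$ but $\mathrm{std}(I_p)$ is not the reduction modulo $p$ of $\mathrm{std}(I)$ (including the case that $p$ divides a denominator of $\mathrm{std}(I)$). **Theorem 4.2.** 1. (Correctness) For all choices made in the algorithm, if it returns $G$, then $G$ is the (reduced) Gröbner basis of $I$. 2. (Termination) The algorithm stops and returns some $G$, provided that no misleading prime is ever put on the list $P$ and that the choices are made so that, if the loop went on forever, no prime would be put on the list $P$ twice, the number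 of primes added in a single round would be unbounded, and infinitely many different primes would be used in the final tests. Such choices exist. 3. Only finitely many primes are misleading, and none is if all elements of $F$ are homogeneous. -/

import Mathlib

open MvPolynomial
open scoped MonomialOrder

noncomputable section

namespace SymGB

/-! ### Gröbner bases

Monomials are identified with their exponent vectors; divisibility of monomials is the
componentwise order `≤` on exponent vectors. -/

/-- The exponents of the leading monomials of the nonzero elements of a set of polynomials. -/
def leadingExponents {ι R : Type*} [CommRing R] (m : MonomialOrder ι)
    (S : Set (MvPolynomial ι R)) : Set (ι →₀ ℕ) :=
  {a | ∃ f ∈ S, f ≠ 0 ∧ m.degree f = a}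

/-- `G` is a Gröbner basis of the ideal `I`: a finite subset of `I` such that the leading monomial
of every nonzero element of `I` is divisible by the leading monomial of some element of `G`. -/
structure IsGroebnerBasis {ι R : Type*} [CommRing R] (m : MonomialOrder ι)
    (G : Set (MvPolynomial ι R)) (I : Ideal (MvPolynomial ι R)) : Prop where
  finite : G.Finite
  subset : G ⊆ (I : Set (MvPolynomial ι R))
  exists_dvd : ∀ f ∈ I, f ≠ 0 → ∃ g ∈ G, g ≠ 0 ∧ m.degree g ≤ m.degree f

/-- `G` is the reduced Gröbner basis of the ideal `I`. -/
structure IsReducedGroebnerBasis {ι R : Type*} [CommRing R] (m : MonomialOrder ι)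
    (G : Set (MvPolynomial ι R)) (I : Ideal (MvPolynomial ι R)) : Prop
    extends IsGroebnerBasis m G I where
  zero_notMem : (0 : MvPolynomial ι R) ∉ G
  not_dvd : ∀ f ∈ G, ∀ g ∈ G, f ≠ g → ¬ m.degree g ≤ m.degree f
  leadingCoeff_eq : ∀ g ∈ G, m.leadingCoeff g = 1
  tail : ∀ g ∈ G, ∀ b ∈ g.support, b ≠ m.degree g → ∀ h ∈ G, ¬ m.degree h ≤ b

/-- The procedure `std`: the reduced Gröbner basis of `I`, described explicitly. It consists of the
`g ∈ I` with leading coefficient `1` whose leading monomial is a minimal generator of the leading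
ideal of `I` and whose tail contains no monomial of the leading ideal of `I`. -/
def std {ι R : Type*} [CommRing R] (m : MonomialOrder ι)
    (I : Ideal (MvPolynomial ι R)) : Set (MvPolynomial ι R) :=
  {g | g ∈ I ∧ g ≠ 0 ∧ m.leadingCoeff g = 1 ∧
    (∀ f ∈ I, f ≠ 0 → m.degree f ≤ m.degree g → m.degree f = m.degree g) ∧
    ∀ b ∈ g.support, b ≠ m.degree g → ∀ f ∈ I, f ≠ 0 → ¬ m.degree f ≤ b}

/-! ### The linear transformation and the symmetric algorithm -/

/-- A cycle decomposition `σ = (e₁₁ … e₁ₗ₁) ⋯ (eₜ₁ … eₜₗₜ)` (fixed points are cycles of length one).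
Positions inside a cycle are counted from `0`. -/
structure CycleDecomposition {n : ℕ} (σ : Equiv.Perm (Fin n)) where
  num : ℕ
  len : Fin num → ℕ
  len_pos : ∀ c, 0 < len c
  entry : (Σ c : Fin num, Fin (len c)) ≃ Fin n
  map_entry : ∀ (c : Fin num) (i : Fin (len c)),
    σ (entry ⟨c, i⟩) = entry ⟨c, finRotate (len c) i⟩

/-- The eigenvector `y_v` of `σ` attached to the variable `x_v`: if `v` is the entry at position `i`
(counted from `0`) of a cycle of length `l`, then `y_v = ∑_{j < l} ξ_l ^ (i j) x_{σ^j(v)}`, where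
`ξ_l = ξ ^ (k / l)` and `k` is the order of `σ`. -/
def eigenform {n : ℕ} {K : Type*} [CommRing K] {σ : Equiv.Perm (Fin n)}
    (d : CycleDecomposition σ) (ξ : K) (v : Fin n) : MvPolynomial (Fin n) K :=
  ∑ j : Fin (d.len (d.entry.symm v).1),
    C ((ξ ^ (orderOf σ / d.len (d.entry.symm v).1)) ^ (((d.entry.symm v).2 : ℕ) * (j : ℕ))) *
      X ((σ ^ (j : ℕ)) v)

/-- The linear transformation `τ`, sending each variable to the corresponding eigenvector. -/
def tau {n : ℕ} {K : Type*} [CommRing K] {σ : Equiv.Perm (Fin n)}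
    (d : CycleDecomposition σ) (ξ : K) :
    MvPolynomial (Fin n) K →ₐ[K] MvPolynomial (Fin n) K :=
  aeval (eigenform d ξ)

open Classical in
/-- The algorithm `symmStd` over a field `K` containing a primitive `k`-th root of unity `ξ`, where
`k` is the order of `σ`: compute `Gτ = std (τ(I))` and return `std ⟨τ⁻¹(Gτ)⟩`; nothing is computed
if the characteristic divides `k`. For invertible `τ` the preimage of `Gτ` under `τ` is `τ⁻¹(Gτ)`,
and `Ideal.map τ I` is the image `τ(I)`. -/
def symmStd {n : ℕ} {K : Type*} [CommRing K] (m : MonomialOrder (Fin n))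
    {σ : Equiv.Perm (Fin n)} (d : CycleDecomposition σ) (ξ : K)
    (I : Ideal (MvPolynomial (Fin n) K)) : Set (MvPolynomial (Fin n) K) :=
  if (orderOf σ : K) = 0 then ∅
  else std m (Ideal.span (tau d ξ ⁻¹' std m (I.map (tau d ξ))))

/-! ### Reduction modulo a prime and lucky primes -/

/-- `p` divides no denominator of a coefficient of a polynomial in `S`. -/
def IntegralAt {ι : Type*} (p : ℕ) (S : Set (MvPolynomial ι ℚ)) : Prop :=
  ∀ f ∈ S, ∀ b : ι →₀ ℕ, ¬ p ∣ (coeff b f).den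

/-- `p` divides no numerator and no denominator of a nonzero coefficient of a polynomial in `S`. -/
def UnitAt {ι : Type*} (p : ℕ) (S : Set (MvPolynomial ι ℚ)) : Prop :=
  ∀ f ∈ S, ∀ b ∈ f.support, ¬ p ∣ (coeff b f).num.natAbs ∧ ¬ p ∣ (coeff b f).den

/-- Reduction modulo `p` of a rational number (used only if `p` does not divide its denominator). -/
def reduceCoeff (p : ℕ) (q : ℚ) : ZMod p := (q.num : ZMod p) * (q.den : ZMod p)⁻¹

/-- Coefficientwise reduction modulo `p`. -/
def reduceMod {ι : Type*} (p : ℕ) (f : MvPolynomial ι ℚ) : MvPolynomial ι (ZMod p) :=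
  ∑ b ∈ f.support, monomial b (reduceCoeff p (coeff b f))

/-- The ideal `I_p` generated by the reductions modulo `p` of the given generators of `I`. -/
def modIdeal {ι : Type*} (p : ℕ) (F : Set (MvPolynomial ι ℚ)) :
    Ideal (MvPolynomial ι (ZMod p)) :=
  Ideal.span (reduceMod p '' F)

/-- `p` is lucky for the ideal generated by `F`: the reduced Gröbner bases of `⟨F⟩` and of
`⟨F mod p⟩` have the same leading monomials. -/
def IsLucky {ι : Type*} (m : MonomialOrder ι) (F : Set (MvPolynomial ι ℚ)) (p : ℕ) : Prop :=
  leadingExponents m (std m (Ideal.span F)) = leadingExponents m (std m (modIdeal p F))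

/-- A prime `p` (dividing no denominator of `F`) is misleading if the reduced Gröbner bases of
`⟨F⟩` and of `⟨F mod p⟩` have the same leading monomials although the second is not the reduction
modulo `p` of the first. -/
def IsMisleading {ι : Type*} (m : MonomialOrder ι) (F : Set (MvPolynomial ι ℚ)) (p : ℕ) : Prop :=
  p.Prime ∧ IntegralAt p F ∧ IsLucky m F p ∧
    ¬ (IntegralAt p (std m (Ideal.span F)) ∧
      reduceMod p '' std m (Ideal.span F) = std m (modIdeal p F))

/-! ### Homogenization

The additional variable `t` is `X none`; the variable `x_i` is `X (some i)`. -/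

/-- `f^h = t^d f(x₁/t, …, xₙ/t)`, where `d` is the total degree of `f`. -/
def homogenize {ι R : Type*} [CommRing R] (f : MvPolynomial ι R) : MvPolynomial (Option ι) R :=
  ∑ b ∈ f.support, monomial (b.optionElim (f.totalDegree - b.degree)) (coeff b f)

/-- The exponent vectors in the variables `t, x₁, …, xₙ`, to be ordered by `>_h`. -/
def HomExponent {ι : Type*} (_m : MonomialOrder ι) : Type _ := Option ι →₀ ℕ

instance {ι : Type*} (m : MonomialOrder ι) : AddCommMonoid (HomExponent m) :=
  inferInstanceAs (AddCommMonoid (Option ι →₀ ℕ))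

/-- The pair (total degree, part in the original variables) by which `>_h` compares monomials. -/
def homKey {ι : Type*} (m : MonomialOrder ι) (a : HomExponent m) : ℕ ×ₗ m.syn :=
  toLex (Finsupp.degree (show Option ι →₀ ℕ from a),
    m.toSyn (Finsupp.some (show Option ι →₀ ℕ from a)))

theorem degree_option {ι : Type*} (a : Option ι →₀ ℕ) :
    a.degree = a none + a.some.degree :=
  Finsupp.sum_option_index a (fun _ x => x) (fun _ => rfl) (fun _ _ _ => rfl)

theorem homKey_injective {ι : Type*} (m : MonomialOrder ι) : Function.Injective (homKey m) := by
  intro a b h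
  change (Option ι →₀ ℕ) at a b
  have h1 : a.degree = b.degree := congrArg (fun x => (ofLex x).1) h
  have h2 : m.toSyn a.some = m.toSyn b.some := congrArg (fun x => (ofLex x).2) h
  have h3 : a.some = b.some := m.toSyn.injective h2
  rw [degree_option, degree_option, h3] at h1
  refine Finsupp.ext fun o => ?_
  cases o with
  | none => exact Nat.add_right_cancel h1
  | some i => exact DFunLike.congr_fun h3 i

theorem homKey_add {ι : Type*} (m : MonomialOrder ι) (a b : HomExponent m) :
    homKey m (a + b) = homKey m a + homKey m b := by
  change (Option ι →₀ ℕ) at a b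
  change toLex ((a + b).degree, m.toSyn (a + b).some) =
    toLex (a.degree + b.degree, m.toSyn a.some + m.toSyn b.some)
  rw [map_add, Finsupp.some_add, map_add]

instance {ι : Type*} (m : MonomialOrder ι) : LinearOrder (HomExponent m) :=
  LinearOrder.lift' (homKey m) (homKey_injective m)

theorem homExponent_le_iff {ι : Type*} (m : MonomialOrder ι) (a b : HomExponent m) :
    a ≤ b ↔ homKey m a ≤ homKey m b := Iff.rfl

instance {ι : Type*} (m : MonomialOrder ι) : IsOrderedAddMonoid (HomExponent m) where
  add_le_add_left a b h c := by
    rw [homExponent_le_iff] at h ⊢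
    rw [homKey_add, homKey_add]
    exact add_le_add_left h _

instance {ι : Type*} (m : MonomialOrder ι) : WellFoundedLT (HomExponent m) :=
  ⟨InvImage.wf (homKey m) wellFounded_lt⟩

/-- The ordering `>_h`: `X^α t^a >_h X^β t^b` if and only if `|α| + a > |β| + b`, or
`|α| + a = |β| + b` and `X^α > X^β`. -/
def homOrder {ι : Type*} (m : MonomialOrder ι) : MonomialOrder (Option ι) where
  syn := HomExponent m
  toSyn := { toEquiv := Equiv.refl (Option ι →₀ ℕ), map_add' := fun _ _ => rfl }
  toSyn_monotone a b h := by
    have hd : a.degree ≤ b.degree := Finsupp.degree_mono h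
    have hs : m.toSyn a.some ≤ m.toSyn b.some := m.toSyn_monotone fun i => h (some i)
    exact Prod.Lex.toLex_mono (show (a.degree, m.toSyn a.some) ≤ (b.degree, m.toSyn b.some)
      from ⟨hd, hs⟩)

theorem homOrder_lt_iff {ι : Type*} (m : MonomialOrder ι) (a b : Option ι →₀ ℕ) :
    a ≺[homOrder m] b ↔
      a.degree < b.degree ∨ a.degree = b.degree ∧ a.some ≺[m] b.some :=
  Prod.Lex.toLex_lt_toLex (x := (a.degree, m.toSyn a.some)) (y := (b.degree, m.toSyn b.some))

/-- `e` is an exponent such that `(J : t^e) = (J : t^∞)`. -/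
def IsSaturationExponent {ι R : Type*} [CommRing R] (J : Ideal (MvPolynomial (Option ι) R))
    (e : ℕ) : Prop :=
  ∀ (j : ℕ) (f : MvPolynomial (Option ι) R),
    (X none : MvPolynomial (Option ι) R) ^ j * f ∈ J →
      (X none : MvPolynomial (Option ι) R) ^ e * f ∈ J

/-! ### Lifting -/

/-- Chinese remainder algorithm: `a` is the residue modulo `N = ∏_{p ∈ P} p`, `0 ≤ a < N`, which is
congruent to `c p` modulo `p` for all `p ∈ P`. -/
def IsChineseRemainder (P : Finset ℕ) (c : (p : ℕ) → ZMod p) (a : ℕ) : Prop :=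
  a < ∏ p ∈ P, p ∧ ∀ p ∈ P, (a : ZMod p) = c p

/-- Farey rational map: `q = r / s` in lowest terms is the rational number with
`|r|, s ≤ √((N - 1) / 2)`, `gcd(s, N) = 1` and `r ≡ a s` modulo `N` (there is at most one). -/
def IsFareyLift (N a : ℕ) (q : ℚ) : Prop :=
  q.num.natAbs ≤ Nat.sqrt ((N - 1) / 2) ∧ q.den ≤ Nat.sqrt ((N - 1) / 2) ∧
    Nat.Coprime q.den N ∧ (q.num : ZMod N) = (a : ZMod N) * (q.den : ZMod N)

/-- `g` is obtained from the polynomials `h p`, `p ∈ P`, by applying coefficientwise the Chinese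
remainder algorithm and the Farey rational map. -/
def IsPolynomialLift {ι : Type*} (P : Finset ℕ) (h : (p : ℕ) → MvPolynomial ι (ZMod p))
    (g : MvPolynomial ι ℚ) : Prop :=
  ∀ b : ι →₀ ℕ, ∃ a : ℕ, IsChineseRemainder P (fun p => coeff b (h p)) a ∧
    IsFareyLift (∏ p ∈ P, p) a (coeff b g)

/-- `G` is the lift of the sets `GP p`, `p ∈ P`: these all have the same leading monomials, and `G`
consists of the lifts of the elements of the `GP p` with the same leading monomial. There is no
lift if some coefficient is not in the domain of the Farey rational map. -/
def IsLift {ι : Type*} (m : MonomialOrder ι) (P : Finset ℕ)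
    (GP : (p : ℕ) → Set (MvPolynomial ι (ZMod p))) (G : Set (MvPolynomial ι ℚ)) : Prop :=
  ∃ L : Set (ι →₀ ℕ), (∀ p ∈ P, leadingExponents m (GP p) = L) ∧
    (∀ g ∈ G, ∃ b ∈ L, ∃ h : (p : ℕ) → MvPolynomial ι (ZMod p),
      (∀ p ∈ P, h p ∈ GP p ∧ m.degree (h p) = b) ∧ IsPolynomialLift P h g) ∧
    ∀ b ∈ L, ∃ g ∈ G, ∃ h : (p : ℕ) → MvPolynomial ι (ZMod p),
      (∀ p ∈ P, h p ∈ GP p ∧ m.degree (h p) = b) ∧ IsPolynomialLift P h g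

/-! ### The algorithm `syModStd` -/

/-- `deleteUnluckyPrimesSB`: `Q` is a class of largest cardinality of the equivalence relation on
`P` given by equality of the leading monomials of the modular Gröbner bases. -/
def IsMajorityClass {ι : Type*} (m : MonomialOrder ι)
    (GP : (p : ℕ) → Set (MvPolynomial ι (ZMod p))) (P Q : Finset ℕ) : Prop :=
  (∃ L : Set (ι →₀ ℕ), ∀ p, p ∈ Q ↔ p ∈ P ∧ leadingExponents m (GP p) = L) ∧
    ∀ Q' ⊆ P, (∃ L : Set (ι →₀ ℕ), ∀ p ∈ Q', leadingExponents m (GP p) = L) →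
      Q'.card ≤ Q.card

/-- `finalVerificationTests` for the candidate `G` and the input `⟨F⟩`, carried out with the test
prime `p` and the exponent `e`. -/
structure FinalVerification {ι : Type*} (m : MonomialOrder ι) (F : Set (MvPolynomial ι ℚ))
    (p e : ℕ) (G : Set (MvPolynomial ι ℚ)) : Prop where
  /-- `G` modulo `p` is a Gröbner basis of `I_p`. -/
  modular : IsGroebnerBasis m (reduceMod p '' G) (modIdeal p F)
  /-- All elements of `F` reduce to zero with respect to `G`. -/
  input_le : Ideal.span F ≤ Ideal.span G
  /-- `G` is a Gröbner basis of the ideal it generates. -/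
  self : IsGroebnerBasis m G (Ideal.span G)
  /-- `p` is lucky for `⟨F^h ∪ {t^e}⟩` with respect to `>_h`. -/
  lucky : IsLucky (homOrder m)
    (homogenize '' F ∪ {(X none : MvPolynomial (Option ι) ℚ) ^ e}) p

/-- The choices made in the rounds `0, 1, 2, …` of the main loop of `syModStd` on the input
`(⟨F⟩, σ)`, recorded as if the loop were never left. -/
structure Execution {n : ℕ} (m : MonomialOrder (Fin n)) (σ : Equiv.Perm (Fin n))
    (F : Set (MvPolynomial (Fin n) ℚ)) where
  /-- The cycle decomposition of `σ` used to compute `τ`. -/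
  cycles : CycleDecomposition σ
  /-- The chosen roots of unity `ξ_k ∈ 𝔽_p`. -/
  root : (p : ℕ) → ZMod p
  /-- `batch 0` is the initial list of primes, `batch (i + 1)` the set of primes by which the list
  is enlarged at the end of round `i`. -/
  batch : ℕ → Finset ℕ
  /-- The primes that are left in round `i` after the deletion of unlucky primes. -/
  kept : ℕ → Finset ℕ
  /-- The prime used in the final tests of round `i`. -/
  testPrime : ℕ → ℕ
  /-- The exponent of `t` used in the final tests of round `i`. -/
  exponent : ℕ → ℕ
  batch_prime : ∀ i, ∀ p ∈ batch i, p.Prime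
  batch_dvd : ∀ i, ∀ p ∈ batch i, orderOf σ ∣ p - 1
  batch_integral : ∀ i, ∀ p ∈ batch i, IntegralAt p F
  root_spec : ∀ i, ∀ p ∈ batch i, IsPrimitiveRoot (root p) (orderOf σ)
  kept_zero : IsMajorityClass m (fun p => symmStd m cycles (root p) (modIdeal p F))
    (batch 0) (kept 0)
  kept_succ : ∀ i, IsMajorityClass m (fun p => symmStd m cycles (root p) (modIdeal p F))
    (kept i ∪ batch (i + 1)) (kept (i + 1))
  testPrime_prime : ∀ i, (testPrime i).Prime
  testPrime_notMem : ∀ i, testPrime i ∉ kept i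
  testPrime_input : ∀ i, UnitAt (testPrime i) F
  testPrime_lift : ∀ i G,
    IsLift m (kept i) (fun p => symmStd m cycles (root p) (modIdeal p F)) G →
      UnitAt (testPrime i) G
  exponent_spec : ∀ i,
    IsSaturationExponent (modIdeal (testPrime i) (homogenize '' F)) (exponent i)

/-- In round `i` the modular bases lift to `G`, and `G` passes the final tests. -/
def Execution.Passes {n : ℕ} {m : MonomialOrder (Fin n)} {σ : Equiv.Perm (Fin n)}
    {F : Set (MvPolynomial (Fin n) ℚ)} (r : Execution m σ F) (i : ℕ)
    (G : Set (MvPolynomial (Fin n) ℚ)) : Prop :=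
  IsLift m (r.kept i) (fun p => symmStd m r.cycles (r.root p) (modIdeal p F)) G ∧
    FinalVerification m F (r.testPrime i) (r.exponent i) G

/-- The algorithm stops and returns `G`: the first round in which a candidate passes the final tests
has the candidate `G`. -/
def Execution.Returns {n : ℕ} {m : MonomialOrder (Fin n)} {σ : Equiv.Perm (Fin n)}
    {F : Set (MvPolynomial (Fin n) ℚ)} (r : Execution m σ F)
    (G : Set (MvPolynomial (Fin n) ℚ)) : Prop :=
  ∃ i, r.Passes i G ∧ ∀ j < i, ∀ G', ¬ r.Passes j G'

/-- What is required of the choices for termination: no prime is added to the list twice, the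
numbers of primes added in a round are not bounded, the test primes do not all stem from a finite
set, and no misleading prime is put on the list. -/
structure Execution.IsGeneric {n : ℕ} {m : MonomialOrder (Fin n)} {σ : Equiv.Perm (Fin n)}
    {F : Set (MvPolynomial (Fin n) ℚ)} (r : Execution m σ F) : Prop where
  fresh : ∀ i j, i ≠ j → Disjoint (r.batch i) (r.batch j)
  unbounded : ∀ B : ℕ, ∃ i, B ≤ (r.batch i).card
  testPrimes : (Set.range r.testPrime).Infinite
  not_misleading : ∀ i, ∀ p ∈ r.batch i, ¬ IsMisleading m F p

end SymGB

end

/-! Correctness is a comparison of Hilbert functions. By tests (i) and (iii), at a prime dividing no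
numerator of `G`, the ideals `⟨G⟩` and `I_p` have the same leading monomials, and (ii) gives `⟨F⟩ ⊆
⟨G⟩`. So `⟨F⟩ = ⟨G⟩` as soon as, for every `d`, `⟨F⟩` has at least as many leading monomials of
degree at most `d` as `I_p`. Test (iv) provides this (`ncard_leadingExponentsUpTo_le`). Let `J` and
`J_p` be generated by the homogenizations `F^h` and by their reductions. Reduction never enlarges
the graded pieces of a homogeneous ideal, so `J_p` has at most as many leading monomials of degree
`d + e` as `J`. For a degree ordering, luckiness of `J + ⟨t^e⟩` says that `J` and `J_p` have the
same leading monomials among those not divisible by `t^e`; hence the inequality persists for those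
divisible by `t^e`. Setting `t = 1` sends the latter to leading monomials of degree at most `d`,
injectively for `J`, and onto all those of `I_p` for `J_p`, because `e` is a saturation exponent.
That `G` is reduced is inherited from the modular bases, since rational lifting is unique. These are
genuine reduced bases: `τ` is a discrete Fourier transform on each cycle, hence bijective, so
`symmStd` equals `std` (`symmStd_eq_std`).

For termination, all but finitely many primes are lucky. One batch with more than twice as many
primes as there are unlucky ones makes the lucky class the majority, and its lucky primes are never
lost again. A lucky prime which is not misleading carries the reduction of `std I`, so `std I` is
the lift once the product of the primes is large (`isLift_std`), and it passes the tests at almost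
every test prime.

A misleading prime must divide a denominator in `std I` or in an expression of `std I` through `F`,
or a denominator of `F`; there are finitely many of these. If `F` is homogeneous, a basis of a
graded piece of `I_p` lifts to integral elements of `I`. At a lucky prime the dimensions agree, so
the lifts form a basis through which every integral element of `I` has integral coordinates; it
therefore reduces into `I_p`. -/

noncomputable section

namespace SymGB

/-! ### Leading exponents and reduced Gröbner bases over a field -/

section GroebnerBasics

variable {ι K : Type*} [Field K] (m : MonomialOrder ι)

theorem leadingExponents_mono {R : Type*} [CommRing R] {S T : Set (MvPolynomial ι R)}
    (h : S ⊆ T) : leadingExponents m S ⊆ leadingExponents m T := by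
  rintro a ⟨f, hf, h0, rfl⟩
  exact ⟨f, h hf, h0, rfl⟩

theorem leadingExponents_upward {I : Ideal (MvPolynomial ι K)} {a b : ι →₀ ℕ}
    (ha : a ∈ leadingExponents m (I : Set (MvPolynomial ι K))) (hab : a ≤ b) :
    b ∈ leadingExponents m (I : Set (MvPolynomial ι K)) := by
  classical
  obtain ⟨f, hf, h0, rfl⟩ := ha
  have h1 : (monomial (b - m.degree f) (1 : K)) ≠ 0 := by simp
  refine ⟨monomial (b - m.degree f) 1 * f, I.mul_mem_left _ hf, mul_ne_zero h1 h0, ?_⟩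
  rw [m.degree_mul h1 h0, m.degree_monomial, if_neg one_ne_zero, tsub_add_cancel_of_le hab]

/-- Division is by all nonzero elements of `I` at once: over a field their leading coefficients are
units, and no finite basis is needed. -/
theorem exists_remainder (I : Ideal (MvPolynomial ι K)) (f : MvPolynomial ι K) :
    ∃ r, f - r ∈ I ∧ m.degree r ≼[m] m.degree f ∧
      ∀ c ∈ r.support, c ∉ leadingExponents m (I : Set (MvPolynomial ι K)) := by
  obtain ⟨g, r, hfr, hdeg, hr⟩ := m.div_set (B := {b | b ∈ I ∧ b ≠ 0})
    (fun b hb => by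
      rw [isUnit_iff_ne_zero]
      exact m.leadingCoeff_ne_zero_iff.mpr hb.2) f
  have hsum : m.degree (f - r) ≼[m] m.degree f := by
    rw [hfr, add_sub_cancel_right, ← hfr, Finsupp.linearCombination_apply, Finsupp.sum]
    refine m.degree_sum_le.trans (Finset.sup_le fun b _ => ?_)
    rw [smul_eq_mul, mul_comm]
    exact hdeg b
  refine ⟨r, ?_, ?_, ?_⟩
  · rw [hfr, add_sub_cancel_right, Finsupp.linearCombination_apply]
    exact Ideal.sum_mem _ fun b _ => I.mul_mem_left _ b.2.1
  · have : r = f - (f - r) := by ring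
    rw [this]
    exact m.degree_sub_le.trans (sup_le le_rfl hsum)
  · rintro c hc ⟨b, hb, hb0, rfl⟩
    exact hr _ hc b ⟨hb, hb0⟩ le_rfl

theorem eq_zero_of_support_notMem {R : Type*} [CommRing R] {S : Set (MvPolynomial ι R)}
    {f : MvPolynomial ι R} (hf : f ∈ S)
    (h : ∀ c ∈ f.support, c ∉ leadingExponents m S) : f = 0 := by
  by_contra h0
  exact h _ (m.degree_mem_support h0) ⟨f, hf, h0, rfl⟩

/-- The remainder modulo `I` of an element of `J` lies in `J` but contains no leading exponent of
`J`, so it is zero. -/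
theorem le_of_leadingExponents_subset {I J : Ideal (MvPolynomial ι K)} (hIJ : I ≤ J)
    (h : leadingExponents m (J : Set (MvPolynomial ι K)) ⊆
      leadingExponents m (I : Set (MvPolynomial ι K))) : J ≤ I := by
  intro f hf
  obtain ⟨r, hr, -, hs⟩ := exists_remainder m I f
  have hrJ : r ∈ J := by
    have := J.sub_mem hf (hIJ hr)
    rwa [sub_sub_cancel] at this
  have : r = 0 := eq_zero_of_support_notMem m (S := (J : Set (MvPolynomial ι K))) hrJ
    fun c hc hcJ => hs c hc (h hcJ)
  rwa [this, sub_zero] at hr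

/-- Every leading exponent of `I` is attained by a monic element whose tail is reduced. -/
theorem exists_monic_reduced {I : Ideal (MvPolynomial ι K)} {a : ι →₀ ℕ}
    (ha : a ∈ leadingExponents m (I : Set (MvPolynomial ι K))) :
    ∃ g ∈ I, g ≠ 0 ∧ m.degree g = a ∧ coeff a g = 1 ∧
      ∀ c ∈ g.support, c ≠ a → c ∉ leadingExponents m (I : Set (MvPolynomial ι K)) := by
  classical
  -- The required element is the monomial minus its own remainder modulo `I`.
  obtain ⟨r, hr, hdeg, hs⟩ := exists_remainder m I (monomial a (1 : K))
  rw [m.degree_monomial, if_neg one_ne_zero] at hdeg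
  have har : coeff a r = 0 := by
    by_contra h
    exact hs a (mem_support_iff.mpr h) ha
  have hc1 : coeff a (monomial a (1 : K) - r) = 1 := by
    rw [coeff_sub, har, coeff_monomial, if_pos rfl, sub_zero]
  have hc2 : ∀ c, c ≠ a → coeff c (monomial a (1 : K) - r) = - coeff c r := fun c hc => by
    rw [coeff_sub, coeff_monomial, if_neg hc.symm, zero_sub]
  have h0 : monomial a (1 : K) - r ≠ 0 := fun h => by
    rw [h, coeff_zero] at hc1
    exact zero_ne_one hc1
  refine ⟨_, hr, h0, ?_, hc1, ?_⟩
  · apply m.toSyn.injective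
    refine le_antisymm ?_ (m.le_degree (mem_support_iff.mpr (by rw [hc1]; exact one_ne_zero)))
    refine m.degree_sub_le.trans (sup_le ?_ hdeg)
    exact m.degree_monomial_le _
  · intro c hc hca
    refine hs c ?_
    rw [mem_support_iff] at hc ⊢
    rwa [hc2 c hca, neg_ne_zero] at hc

/-- In this form the conditions on `g` other than `g ∈ I` see the ideal only through its leading
exponents, so they transfer between ideals over different fields. -/
theorem mem_std_iff {R : Type*} [CommRing R] {I : Ideal (MvPolynomial ι R)}
    {g : MvPolynomial ι R} :
    g ∈ std m I ↔ g ∈ I ∧ g ≠ 0 ∧ m.leadingCoeff g = 1 ∧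
      (∀ a ∈ leadingExponents m (I : Set (MvPolynomial ι R)), a ≤ m.degree g → a = m.degree g) ∧
      ∀ b ∈ g.support, b ≠ m.degree g →
        ∀ a ∈ leadingExponents m (I : Set (MvPolynomial ι R)), ¬ a ≤ b := by
  constructor
  · rintro ⟨h1, h2, h3, h4, h5⟩
    refine ⟨h1, h2, h3, ?_, ?_⟩
    · rintro a ⟨f, hf, h0, rfl⟩ hle
      exact h4 f hf h0 hle
    · rintro b hb hbg a ⟨f, hf, h0, rfl⟩
      exact h5 b hb hbg f hf h0
  · rintro ⟨h1, h2, h3, h4, h5⟩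
    exact ⟨h1, h2, h3, fun f hf h0 => h4 _ ⟨f, hf, h0, rfl⟩,
      fun b hb hbg f hf h0 => h5 b hb hbg _ ⟨f, hf, h0, rfl⟩⟩

theorem std_subset {R : Type*} [CommRing R] (I : Ideal (MvPolynomial ι R)) :
    std m I ⊆ (I : Set (MvPolynomial ι R)) := fun _ h => h.1

theorem coeff_degree_of_mem_std {R : Type*} [CommRing R] {I : Ideal (MvPolynomial ι R)}
    {g : MvPolynomial ι R} (hg : g ∈ std m I) : coeff (m.degree g) g = 1 := hg.2.2.1

/-- An element of the reduced Gröbner basis is determined by its leading monomial. -/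
theorem eq_of_mem_std {R : Type*} [CommRing R] {I : Ideal (MvPolynomial ι R)}
    {g h : MvPolynomial ι R} (hg : g ∈ std m I) (hh : h ∈ std m I)
    (hd : m.degree g = m.degree h) : g = h := by
  have hgc := coeff_degree_of_mem_std m hg
  have hhc := coeff_degree_of_mem_std m hh
  rw [mem_std_iff] at hg hh
  rw [← sub_eq_zero]
  -- The leading terms cancel in `g - h`, and both tails avoid the leading exponents of `I`.
  refine eq_zero_of_support_notMem m (S := (I : Set (MvPolynomial ι R)))
    (I.sub_mem hg.1 hh.1) fun c hc hcI => ?_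
  have hcd : c ≠ m.degree g := by
    rintro rfl
    rw [mem_support_iff, coeff_sub, hgc, hd, hhc, sub_self] at hc
    exact hc rfl
  rw [mem_support_iff, coeff_sub] at hc
  by_cases h1 : coeff c g = 0
  · rw [h1, zero_sub, neg_ne_zero] at hc
    exact hh.2.2.2.2 c (mem_support_iff.mpr hc) (hd ▸ hcd) c hcI le_rfl
  · exact hg.2.2.2.2 c (mem_support_iff.mpr h1) hcd c hcI le_rfl

theorem exists_mem_std_degree {I : Ideal (MvPolynomial ι K)} {a : ι →₀ ℕ}
    (ha : Minimal (· ∈ leadingExponents m (I : Set (MvPolynomial ι K))) a) :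
    ∃ g ∈ std m I, m.degree g = a := by
  obtain ⟨g, hg, h0, hd, hc, ht⟩ := exists_monic_reduced m ha.1
  refine ⟨g, (mem_std_iff m).mpr ⟨hg, h0, ?_, ?_, ?_⟩, hd⟩
  · rw [MonomialOrder.leadingCoeff, hd, hc]
  · intro b hb hle
    rw [hd] at hle ⊢
    exact le_antisymm hle (ha.2 hb hle)
  · intro b hb hba c hc hcb
    exact ht b hb (hd ▸ hba) (leadingExponents_upward m hc hcb)

theorem leadingExponents_std (I : Ideal (MvPolynomial ι K)) :
    leadingExponents m (std m I) =
      {a | Minimal (· ∈ leadingExponents m (I : Set (MvPolynomial ι K))) a} := by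
  ext a
  constructor
  · rintro ⟨g, hg, h0, rfl⟩
    refine ⟨⟨g, hg.1, h0, rfl⟩, fun b hb hle => ?_⟩
    exact (((mem_std_iff m).mp hg).2.2.2.1 b hb hle).ge
  · intro ha
    obtain ⟨g, hg, hd⟩ := exists_mem_std_degree m ha
    exact ⟨g, hg, hg.2.1, hd⟩

theorem exists_minimal_leadingExponent [Finite ι] {I : Ideal (MvPolynomial ι K)} {a : ι →₀ ℕ}
    (ha : a ∈ leadingExponents m (I : Set (MvPolynomial ι K))) :
    ∃ b ≤ a, Minimal (· ∈ leadingExponents m (I : Set (MvPolynomial ι K))) b :=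
  exists_minimal_le_of_wellFoundedLT _ a ha

/-- Dickson's lemma: minimal leading exponents form an antichain, and each belongs to only one
element of `std`. -/
theorem std_finite [Finite ι] (I : Ideal (MvPolynomial ι K)) : (std m I).Finite := by
  have hfin : (leadingExponents m (std m I)).Finite := by
    rw [leadingExponents_std]
    exact WellQuasiOrderedLE.finite_of_isAntichain (setOfPred_minimal_antichain _)
  refine Set.Finite.of_finite_image (f := m.degree) (hfin.subset ?_) ?_
  · rintro _ ⟨g, hg, rfl⟩
    exact ⟨g, hg, hg.2.1, rfl⟩
  · intro g hg h hh hd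
    exact eq_of_mem_std m hg hh hd

theorem isGroebnerBasis_std [Finite ι] (I : Ideal (MvPolynomial ι K)) :
    IsGroebnerBasis m (std m I) I where
  finite := std_finite m I
  subset := std_subset m I
  exists_dvd f hf h0 := by
    obtain ⟨b, hb, hmin⟩ := exists_minimal_leadingExponent m (I := I) ⟨f, hf, h0, rfl⟩
    obtain ⟨g, hg, rfl⟩ := exists_mem_std_degree m hmin
    exact ⟨g, hg, hg.2.1, hb⟩

theorem IsGroebnerBasis.mem_leadingExponents_iff {G : Set (MvPolynomial ι K)}
    {I : Ideal (MvPolynomial ι K)} (h : IsGroebnerBasis m G I) {b : ι →₀ ℕ} :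
    b ∈ leadingExponents m (I : Set (MvPolynomial ι K)) ↔
      ∃ a ∈ leadingExponents m G, a ≤ b := by
  constructor
  · rintro ⟨f, hf, h0, rfl⟩
    obtain ⟨g, hg, hg0, hle⟩ := h.exists_dvd f hf h0
    exact ⟨_, ⟨g, hg, hg0, rfl⟩, hle⟩
  · rintro ⟨a, ha, hab⟩
    exact leadingExponents_upward m (leadingExponents_mono m h.subset ha) hab

theorem IsGroebnerBasis.span_eq {G : Set (MvPolynomial ι K)}
    {I : Ideal (MvPolynomial ι K)} (h : IsGroebnerBasis m G I) : Ideal.span G = I := by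
  have hle : Ideal.span G ≤ I := Ideal.span_le.mpr h.subset
  refine le_antisymm hle (le_of_leadingExponents_subset m hle fun b hb => ?_)
  obtain ⟨a, ha, hab⟩ := (h.mem_leadingExponents_iff m).mp hb
  exact leadingExponents_upward m (leadingExponents_mono m Ideal.subset_span ha) hab

theorem span_std [Finite ι] (I : Ideal (MvPolynomial ι K)) : Ideal.span (std m I) = I :=
  (isGroebnerBasis_std m I).span_eq

/-- The reduced Gröbner bases have the same leading monomials if and only if the ideals do. -/
theorem leadingExponents_std_eq_iff [Finite ι] {K' : Type*} [Field K']
    (I : Ideal (MvPolynomial ι K)) (J : Ideal (MvPolynomial ι K')) :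
    leadingExponents m (std m I) = leadingExponents m (std m J) ↔
      leadingExponents m (I : Set (MvPolynomial ι K)) =
        leadingExponents m (J : Set (MvPolynomial ι K')) := by
  constructor
  · intro h
    ext b
    rw [(isGroebnerBasis_std m I).mem_leadingExponents_iff,
      (isGroebnerBasis_std m J).mem_leadingExponents_iff, h]
  · intro h
    rw [leadingExponents_std, leadingExponents_std, h]

end GroebnerBasics

/-! ### Integrality at `p` and reduction modulo `p` -/

section Reduction

theorem reduceCoeff_eq_cast (p : ℕ) [Fact p.Prime] (q : ℚ) : reduceCoeff p q = (q : ZMod p) := by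
  rw [reduceCoeff, Rat.cast_def, div_eq_mul_inv]

theorem natCast_den_ne_zero {p : ℕ} {q : ℚ} (h : ¬ p ∣ q.den) :
    (q.den : ZMod p) ≠ 0 := by
  rwa [Ne, ZMod.natCast_eq_zero_iff]

/-- The ring of rational numbers whose denominator is not divisible by `p`. -/
def integralSubring (p : ℕ) [hp : Fact p.Prime] : Subring ℚ where
  carrier := {q | ¬ p ∣ q.den}
  mul_mem' {a b} ha hb h :=
    ((hp.out.dvd_mul).mp (h.trans (Rat.mul_den_dvd a b))).elim ha hb
  one_mem' h := hp.out.one_lt.ne' (Nat.dvd_one.mp h)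
  add_mem' {a b} ha hb h :=
    ((hp.out.dvd_mul).mp (h.trans (Rat.add_den_dvd a b))).elim ha hb
  zero_mem' h := hp.out.one_lt.ne' (Nat.dvd_one.mp h)
  neg_mem' ha h := ha h

/-- Reduction modulo `p` as a ring homomorphism. -/
def reduceHom (p : ℕ) [Fact p.Prime] : integralSubring p →+* ZMod p where
  toFun a := reduceCoeff p a
  map_one' := by simp [reduceCoeff]
  map_mul' a b := by
    simp only [reduceCoeff_eq_cast]
    exact Rat.cast_mul_of_ne_zero (natCast_den_ne_zero a.2) (natCast_den_ne_zero b.2)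
  map_zero' := by simp [reduceCoeff]
  map_add' a b := by
    simp only [reduceCoeff_eq_cast]
    exact Rat.cast_add_of_ne_zero (natCast_den_ne_zero a.2) (natCast_den_ne_zero b.2)

theorem reduceHom_apply (p : ℕ) [Fact p.Prime] (a : integralSubring p) :
    reduceHom p a = reduceCoeff p a := rfl

theorem reduceCoeff_zero (p : ℕ) : reduceCoeff p 0 = 0 := by simp [reduceCoeff]

theorem reduceCoeff_one (p : ℕ) : reduceCoeff p 1 = 1 := by simp [reduceCoeff]

theorem natCast_mem_integralSubring (p : ℕ) [Fact p.Prime] (k : ℕ) :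
    (k : ℚ) ∈ integralSubring p := natCast_mem _ k

/-- An integral number reducing to zero is divisible by `p`. -/
theorem mem_integralSubring_of_mul {p : ℕ} [hp : Fact p.Prime] {x : ℚ}
    (hx : (p : ℚ) * x ∈ integralSubring p) (h0 : reduceCoeff p (p * x) = 0) :
    x ∈ integralSubring p := by
  set y : ℚ := p * x with hy
  have hnum : (p : ℤ) ∣ y.num := by
    rw [reduceCoeff, mul_eq_zero, or_iff_left (inv_ne_zero (natCast_den_ne_zero hx))] at h0
    exact (ZMod.intCast_zmod_eq_zero_iff_dvd _ _).mp h0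
  obtain ⟨a, ha⟩ := hnum
  have hp0 : (p : ℚ) ≠ 0 := by exact_mod_cast hp.out.ne_zero
  have hx' : x = Rat.divInt a (y.den : ℤ) := by
    rw [Rat.divInt_eq_div]
    have h1 : y = y.num / y.den := (Rat.num_div_den y).symm
    rw [ha] at h1
    have h2 : (p : ℚ) * x = p * (a / y.den) := by
      refine (hy.symm.trans h1).trans ?_
      rw [Int.cast_mul, Int.cast_natCast, mul_div_assoc]
    simpa using mul_left_cancel₀ hp0 h2
  intro hd
  apply hx
  have h3 := Rat.den_dvd a (y.den : ℤ)
  rw [← hx'] at h3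
  exact hd.trans (Int.natCast_dvd_natCast.mp h3)

theorem exists_pow_mul_mem_integralSubring (p : ℕ) [hp : Fact p.Prime] (x : ℚ) :
    ∃ k : ℕ, (p : ℚ) ^ k * x ∈ integralSubring p := by
  obtain ⟨k, d, hd, hden⟩ := Nat.exists_eq_pow_mul_and_not_dvd x.den_nz p hp.out.ne_one
  refine ⟨k, fun h => hd ?_⟩
  have hp0 : (p : ℚ) ≠ 0 := by exact_mod_cast hp.out.ne_zero
  have hx : (p : ℚ) ^ k * x = Rat.divInt x.num (d : ℤ) := by
    rw [Rat.divInt_eq_div]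
    conv_lhs => rw [← Rat.num_div_den x, hden]
    push_cast
    field_simp
  rw [hx] at h
  exact h.trans (Int.natCast_dvd_natCast.mp (Rat.den_dvd x.num (d : ℤ)))

theorem exists_pow_mul_mem_integralSubring_finset (p : ℕ) [Fact p.Prime] {κ : Type*}
    (s : Finset κ) (c : κ → ℚ) :
    ∃ k : ℕ, ∀ i ∈ s, (p : ℚ) ^ k * c i ∈ integralSubring p := by
  choose k hk using fun i => exists_pow_mul_mem_integralSubring p (c i)
  refine ⟨∑ i ∈ s, k i, fun i hi => ?_⟩
  obtain ⟨j, hj⟩ := Nat.exists_eq_add_of_le (Finset.single_le_sum (f := k)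
    (fun _ _ => Nat.zero_le _) hi)
  rw [hj, pow_add, mul_comm ((p : ℚ) ^ k i), mul_assoc]
  exact mul_mem (pow_mem (natCast_mem_integralSubring p p) j) (hk i)

variable {ι : Type*}

/-- All coefficients of `f` have a denominator which is not divisible by `p`. -/
def IntegralPoly (p : ℕ) (f : MvPolynomial ι ℚ) : Prop := ∀ b, ¬ p ∣ (coeff b f).den

theorem coeff_reduceMod (p : ℕ) (f : MvPolynomial ι ℚ) (b : ι →₀ ℕ) :
    coeff b (reduceMod p f) = reduceCoeff p (coeff b f) := by
  classical
  simp only [reduceMod, coeff_sum, coeff_monomial]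
  rw [Finset.sum_ite_eq']
  split_ifs with h
  · rfl
  · rw [notMem_support_iff.mp h, reduceCoeff_zero]

theorem reduceMod_zero (p : ℕ) : reduceMod p (0 : MvPolynomial ι ℚ) = 0 := by
  simp [reduceMod]

theorem support_reduceMod_subset (p : ℕ) (f : MvPolynomial ι ℚ) :
    (reduceMod p f).support ⊆ f.support := by
  intro b hb
  rw [mem_support_iff, coeff_reduceMod] at hb
  rw [mem_support_iff]
  intro h
  rw [h, reduceCoeff_zero] at hb
  exact hb rfl

theorem degree_reduceMod (m : MonomialOrder ι) {p : ℕ} {f : MvPolynomial ι ℚ}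
    (h : reduceCoeff p (coeff (m.degree f) f) ≠ 0) :
    m.degree (reduceMod p f) = m.degree f := by
  apply m.toSyn.injective
  refine le_antisymm ?_ (m.le_degree ?_)
  · exact m.degree_le_iff.mpr fun b hb => m.le_degree (support_reduceMod_subset p f hb)
  · rwa [mem_support_iff, coeff_reduceMod]

variable {p : ℕ} [hp : Fact p.Prime]

/-- On polynomials over the local ring, reduction is induced by a ring homomorphism; the sum and
product rules come from here. -/
theorem reduceMod_map (f : MvPolynomial ι (integralSubring p)) :
    reduceMod p (map (integralSubring p).subtype f) = map (reduceHom p) f := by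
  ext b
  rw [coeff_reduceMod, coeff_map, coeff_map, reduceHom_apply]
  rfl

theorem integralPoly_map (f : MvPolynomial ι (integralSubring p)) :
    IntegralPoly p (map (integralSubring p).subtype f) := by
  intro b
  rw [coeff_map]
  exact (coeff b f).2

theorem IntegralPoly.exists_map {f : MvPolynomial ι ℚ} (h : IntegralPoly p f) :
    ∃ g : MvPolynomial ι (integralSubring p), map (integralSubring p).subtype g = f := by
  refine ⟨∑ b ∈ f.support, monomial b ⟨coeff b f, h b⟩, ?_⟩
  rw [map_sum]
  conv_rhs => rw [f.as_sum]
  exact Finset.sum_congr rfl fun b _ => by rw [map_monomial]; rfl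

theorem IntegralPoly.zero : IntegralPoly p (0 : MvPolynomial ι ℚ) := fun b => by
  rw [coeff_zero]
  exact (integralSubring p).zero_mem

theorem IntegralPoly.add {f g : MvPolynomial ι ℚ} (hf : IntegralPoly p f)
    (hg : IntegralPoly p g) : IntegralPoly p (f + g) := fun b => by
  rw [coeff_add]
  exact (integralSubring p).add_mem (hf b) (hg b)

theorem IntegralPoly.sub {f g : MvPolynomial ι ℚ} (hf : IntegralPoly p f)
    (hg : IntegralPoly p g) : IntegralPoly p (f - g) := fun b => by
  rw [coeff_sub]
  exact (integralSubring p).sub_mem (hf b) (hg b)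

theorem IntegralPoly.mul {f g : MvPolynomial ι ℚ} (hf : IntegralPoly p f)
    (hg : IntegralPoly p g) : IntegralPoly p (f * g) := by
  obtain ⟨f, rfl⟩ := hf.exists_map
  obtain ⟨g, rfl⟩ := hg.exists_map
  rw [← map_mul]
  exact integralPoly_map _

theorem IntegralPoly.C_mul {f : MvPolynomial ι ℚ} (hf : IntegralPoly p f) {c : ℚ}
    (hc : c ∈ integralSubring p) : IntegralPoly p (C c * f) := fun b => by
  rw [coeff_C_mul]
  exact (integralSubring p).mul_mem hc (hf b)

theorem IntegralPoly.sum {κ : Type*} {s : Finset κ} {f : κ → MvPolynomial ι ℚ}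
    (h : ∀ i ∈ s, IntegralPoly p (f i)) : IntegralPoly p (∑ i ∈ s, f i) := fun b => by
  rw [coeff_sum]
  exact (integralSubring p).sum_mem fun i hi => h i hi b

theorem reduceMod_add {f g : MvPolynomial ι ℚ} (hf : IntegralPoly p f)
    (hg : IntegralPoly p g) : reduceMod p (f + g) = reduceMod p f + reduceMod p g := by
  obtain ⟨f, rfl⟩ := hf.exists_map
  obtain ⟨g, rfl⟩ := hg.exists_map
  rw [← map_add, reduceMod_map, reduceMod_map, reduceMod_map, map_add]

theorem reduceMod_mul {f g : MvPolynomial ι ℚ} (hf : IntegralPoly p f)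
    (hg : IntegralPoly p g) : reduceMod p (f * g) = reduceMod p f * reduceMod p g := by
  obtain ⟨f, rfl⟩ := hf.exists_map
  obtain ⟨g, rfl⟩ := hg.exists_map
  rw [← map_mul, reduceMod_map, reduceMod_map, reduceMod_map, map_mul]

theorem reduceMod_sum {κ : Type*} {s : Finset κ} {f : κ → MvPolynomial ι ℚ}
    (h : ∀ i ∈ s, IntegralPoly p (f i)) :
    reduceMod p (∑ i ∈ s, f i) = ∑ i ∈ s, reduceMod p (f i) := by
  classical
  induction s using Finset.induction_on with
  | empty => simp [reduceMod]
  | insert a s ha ih =>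
    rw [Finset.sum_insert ha, Finset.sum_insert ha,
      reduceMod_add (h a (Finset.mem_insert_self a s))
        (IntegralPoly.sum fun i hi => h i (Finset.mem_insert_of_mem hi)),
      ih fun i hi => h i (Finset.mem_insert_of_mem hi)]

theorem reduceMod_C_mul {f : MvPolynomial ι ℚ} (hf : IntegralPoly p f) {c : ℚ}
    (hc : c ∈ integralSubring p) :
    reduceMod p (C c * f) = C (reduceCoeff p c) * reduceMod p f := by
  ext b
  rw [coeff_reduceMod, coeff_C_mul, coeff_C_mul, coeff_reduceMod]
  exact map_mul (reduceHom p) ⟨c, hc⟩ ⟨_, hf b⟩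

theorem reduceMod_monomial (p : ℕ) (b : ι →₀ ℕ) (c : ℚ) :
    reduceMod p (monomial b c) = monomial b (reduceCoeff p c) := by
  classical
  ext a
  rw [coeff_reduceMod, coeff_monomial, coeff_monomial]
  split_ifs
  · rfl
  · exact reduceCoeff_zero p

theorem integralPoly_monomial {c : ℚ} (hc : c ∈ integralSubring p) (b : ι →₀ ℕ) :
    IntegralPoly p (monomial b c) := by
  classical
  intro a
  rw [coeff_monomial]
  split_ifs
  · exact hc
  · exact (integralSubring p).zero_mem

theorem exists_integralPoly_reduceMod (w : MvPolynomial ι (ZMod p)) :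
    ∃ f : MvPolynomial ι ℚ, IntegralPoly p f ∧ reduceMod p f = w := by
  have h : ∀ b ∈ w.support, IntegralPoly p (monomial b ((coeff b w).val : ℚ)) := fun b _ =>
    integralPoly_monomial (natCast_mem_integralSubring p _) b
  refine ⟨∑ b ∈ w.support, monomial b ((coeff b w).val : ℚ), IntegralPoly.sum h, ?_⟩
  rw [reduceMod_sum h]
  conv_rhs => rw [w.as_sum]
  refine Finset.sum_congr rfl fun b _ => ?_
  rw [reduceMod_monomial, reduceCoeff_eq_cast, Rat.cast_natCast, ZMod.natCast_zmod_val]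

/-- An integral polynomial reducing to zero is divisible by `p`. -/
theorem IntegralPoly.of_mul_of_reduceMod_eq_zero {f : MvPolynomial ι ℚ}
    (hf : IntegralPoly p (C (p : ℚ) * f)) (h0 : reduceMod p (C (p : ℚ) * f) = 0) :
    IntegralPoly p f := by
  intro b
  have h1 := hf b
  have h2 := coeff_reduceMod p (C (p : ℚ) * f) b
  rw [h0, coeff_zero] at h2
  rw [coeff_C_mul] at h1 h2
  exact mem_integralSubring_of_mul h1 h2.symm

theorem exists_pow_mul_integralPoly (p : ℕ) [Fact p.Prime] (f : MvPolynomial ι ℚ) :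
    ∃ k : ℕ, IntegralPoly p (C ((p : ℚ) ^ k) * f) := by
  obtain ⟨k, hk⟩ := exists_pow_mul_mem_integralSubring_finset p f.support (fun b => coeff b f)
  refine ⟨k, fun b => ?_⟩
  rw [coeff_C_mul]
  by_cases hb : b ∈ f.support
  · exact hk b hb
  · rw [notMem_support_iff.mp hb, mul_zero]
    exact (integralSubring p).zero_mem

/-- If the reductions of integral polynomials are linearly independent, then an integral linear
combination of them has integral coefficients. -/
theorem mem_integralSubring_of_linearIndependent {κ : Type*} [Fintype κ]
    {v : κ → MvPolynomial ι ℚ} (hv : ∀ s, IntegralPoly p (v s))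
    (hli : LinearIndependent (ZMod p) fun s => reduceMod p (v s)) (c : κ → ℚ)
    (hf : IntegralPoly p (∑ s, C (c s) * v s)) (s : κ) : c s ∈ integralSubring p := by
  obtain ⟨k, hk⟩ := exists_pow_mul_mem_integralSubring_finset p Finset.univ c
  -- Descent on the power of `p` clearing the denominators. The sum multiplied by `p ^ (k + 1)`
  -- reduces to zero, so by independence every `p ^ (k + 1) * c i` reduces to zero and one factor
  -- `p` can be dropped.
  have key : ∀ k : ℕ, (∀ i, (p : ℚ) ^ k * c i ∈ integralSubring p) →
      ∀ i, c i ∈ integralSubring p := by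
    intro k
    induction k with
    | zero =>
      intro h i
      simpa using h i
    | succ k ih =>
      intro h
      refine ih fun i => ?_
      have hred : ∑ i, reduceCoeff p ((p : ℚ) ^ (k + 1) * c i) • reduceMod p (v i) = 0 := by
        have h1 : C ((p : ℚ) ^ (k + 1)) * ∑ s, C (c s) * v s =
            ∑ s, C ((p : ℚ) ^ (k + 1) * c s) * v s := by
          rw [Finset.mul_sum]
          exact Finset.sum_congr rfl fun i _ => by rw [C_mul, mul_assoc]
        have h2 := congrArg (reduceMod p) h1
        rw [reduceMod_C_mul hf (pow_mem (natCast_mem_integralSubring p p) _),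
          reduceMod_sum fun i _ => (hv i).C_mul (h i)] at h2
        have h3 : reduceCoeff p ((p : ℚ) ^ (k + 1)) = 0 := by
          rw [reduceCoeff_eq_cast]
          have : ((p : ℚ) ^ (k + 1)) = ((p ^ (k + 1) : ℕ) : ℚ) := by push_cast; rfl
          rw [this, Rat.cast_natCast]
          simp
        rw [h3, C_0, zero_mul] at h2
        rw [h2]
        exact Finset.sum_congr rfl fun i _ => by
          rw [reduceMod_C_mul (hv i) (h i), smul_eq_C_mul]
      have h4 := Fintype.linearIndependent_iff.mp hli _ hred i
      have h5 := h i
      rw [pow_succ', mul_assoc] at h4 h5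
      exact mem_integralSubring_of_mul h5 h4
  exact key k (fun i => hk i (Finset.mem_univ i)) s

/-- A nontrivial relation can be rescaled to have any rational number as its `i`-th coefficient. Its
sum, zero, is integral, so by the preceding lemma every rational would be integral, even `1 / p`. -/
theorem linearIndependent_of_reduceMod {κ : Type*} [Finite κ]
    {v : κ → MvPolynomial ι ℚ} (hv : ∀ s, IntegralPoly p (v s))
    (hli : LinearIndependent (ZMod p) fun s => reduceMod p (v s)) : LinearIndependent ℚ v := by
  cases nonempty_fintype κ
  rw [Fintype.linearIndependent_iff]
  intro c hc i
  by_contra hci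
  have hp0 : (p : ℚ) ≠ 0 := by exact_mod_cast hp.out.ne_zero
  have hall : ∀ x : ℚ, x ∈ integralSubring p := fun x => by
    have := mem_integralSubring_of_linearIndependent hv hli (fun s => x / c i * c s)
      (by
        have : ∑ s, C (x / c i * c s) * v s = 0 := by
          simp_rw [C_mul, mul_assoc, ← Finset.mul_sum, ← smul_eq_C_mul, hc, smul_zero]
        rw [this]
        exact IntegralPoly.zero) i
    rwa [div_mul_cancel₀ _ hci] at this
  apply hall ((p : ℚ)⁻¹)
  rw [Rat.inv_natCast_den, if_neg hp.out.ne_zero]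

end Reduction

/-! ### Comparing the reduced basis of an ideal with that of its reduction -/

section Lucky

variable {ι : Type*} (m : MonomialOrder ι) {p : ℕ} [hp : Fact p.Prime]

theorem exists_integralPoly_of_mem_modIdeal {F : Set (MvPolynomial ι ℚ)} (hF : IntegralAt p F)
    {w : MvPolynomial ι (ZMod p)} (hw : w ∈ modIdeal p F) :
    ∃ f ∈ Ideal.span F, IntegralPoly p f ∧ reduceMod p f = w := by
  induction hw using Submodule.span_induction with
  | mem x hx =>
    obtain ⟨f, hf, rfl⟩ := hx
    exact ⟨f, Ideal.subset_span hf, hF f hf, rfl⟩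
  | zero => exact ⟨0, Ideal.zero_mem _, IntegralPoly.zero, reduceMod_zero p⟩
  | add x y _ _ hx hy =>
    obtain ⟨f, hf, hfi, rfl⟩ := hx
    obtain ⟨g, hg, hgi, rfl⟩ := hy
    exact ⟨f + g, Ideal.add_mem _ hf hg, hfi.add hgi, reduceMod_add hfi hgi⟩
  | smul a x _ hx =>
    obtain ⟨f, hf, hfi, rfl⟩ := hx
    obtain ⟨g, hgi, rfl⟩ := exists_integralPoly_reduceMod a
    exact ⟨g * f, Ideal.mul_mem_left _ _ hf, hgi.mul hfi, reduceMod_mul hgi hfi⟩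

/-- If the integral elements of `I` reduce to elements of `Ip` and both ideals have the same
leading monomials, then the reduced Gröbner basis of `I` reduces to the one of `Ip`. -/
theorem reduceMod_image_std [Finite ι] {I : Ideal (MvPolynomial ι ℚ)}
    {Ip : Ideal (MvPolynomial ι (ZMod p))}
    (hred : ∀ f ∈ I, IntegralPoly p f → reduceMod p f ∈ Ip)
    (hLE : leadingExponents m (I : Set (MvPolynomial ι ℚ)) =
      leadingExponents m (Ip : Set (MvPolynomial ι (ZMod p)))) :
    IntegralAt p (std m I) ∧ reduceMod p '' std m I = std m Ip := by
  have hint : ∀ g ∈ std m I, IntegralPoly p g := by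
    intro g hg
    have hg' := (mem_std_iff m).mp hg
    -- Denominators are removed one factor `p` at a time: `p ^ (k + 1) * g` reduces to an element of
    -- `Ip` whose leading term has vanished and whose tail avoids the leading exponents of `Ip`,
    -- hence to zero.
    obtain ⟨k, hk⟩ := exists_pow_mul_integralPoly p g
    induction k with
    | zero => simpa using hk
    | succ k ih =>
      refine ih ?_
      have hmul : C ((p : ℚ) ^ (k + 1)) * g = C (p : ℚ) * (C ((p : ℚ) ^ k) * g) := by
        rw [pow_succ', C_mul, mul_assoc]
      have hz : reduceMod p (C ((p : ℚ) ^ (k + 1)) * g) = 0 := by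
        refine eq_zero_of_support_notMem m (S := (Ip : Set (MvPolynomial ι (ZMod p))))
          (hred _ (I.mul_mem_left _ hg.1) hk) fun c hc hcI => ?_
        rw [mem_support_iff, coeff_reduceMod, coeff_C_mul] at hc
        rw [← hLE] at hcI
        refine hg'.2.2.2.2 c ?_ ?_ c hcI le_rfl
        · rw [mem_support_iff]
          intro h
          rw [h, mul_zero, reduceCoeff_zero] at hc
          exact hc rfl
        · rintro rfl
          rw [coeff_degree_of_mem_std m hg, mul_one, reduceCoeff_eq_cast] at hc
          have : ((p : ℚ) ^ (k + 1)) = ((p ^ (k + 1) : ℕ) : ℚ) := by push_cast; rfl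
          rw [this, Rat.cast_natCast] at hc
          simp at hc
      rw [hmul] at hz hk
      exact hk.of_mul_of_reduceMod_eq_zero hz
  have hdeg : ∀ g ∈ std m I, m.degree (reduceMod p g) = m.degree g := fun g hg =>
    degree_reduceMod m (by
      rw [coeff_degree_of_mem_std m hg, reduceCoeff_one]
      exact one_ne_zero)
  have hmem : ∀ g ∈ std m I, reduceMod p g ∈ std m Ip := by
    intro g hg
    have hg' := (mem_std_iff m).mp hg
    have hc : coeff (m.degree g) (reduceMod p g) = 1 := by
      rw [coeff_reduceMod, coeff_degree_of_mem_std m hg, reduceCoeff_one]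
    refine (mem_std_iff m).mpr ⟨hred g hg.1 (hint g hg), ?_, ?_, ?_, ?_⟩
    · intro h
      rw [h, coeff_zero] at hc
      exact zero_ne_one hc
    · rw [MonomialOrder.leadingCoeff, hdeg g hg, hc]
    · rw [hdeg g hg, ← hLE]
      exact hg'.2.2.2.1
    · rw [hdeg g hg, ← hLE]
      exact fun b hb => hg'.2.2.2.2 b (support_reduceMod_subset p g hb)
  refine ⟨hint, Set.Subset.antisymm ?_ ?_⟩
  · rintro _ ⟨g, hg, rfl⟩
    exact hmem g hg
  · intro w hw
    have hmin : m.degree w ∈ leadingExponents m (std m Ip) := ⟨w, hw, hw.2.1, rfl⟩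
    rw [leadingExponents_std, ← hLE] at hmin
    obtain ⟨g, hg, hd⟩ := exists_mem_std_degree m hmin
    exact ⟨g, hg, eq_of_mem_std m (hmem g hg) hw ((hdeg g hg).trans hd)⟩

theorem degree_map_of_injective {R S : Type*} [CommRing R] [CommRing S] {φ : R →+* S}
    (hφ : Function.Injective φ) (f : MvPolynomial ι R) : m.degree (map φ f) = m.degree f := by
  simp only [MonomialOrder.degree, support_map_of_injective f hφ]

/-- Division with remainder by an integral reduced Gröbner basis preserves integrality. -/
theorem exists_integralPoly_remainder [Finite ι] {I : Ideal (MvPolynomial ι ℚ)}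
    (hstd : IntegralAt p (std m I)) {f : MvPolynomial ι ℚ} (hf : IntegralPoly p f) :
    ∃ r, IntegralPoly p r ∧ f - r ∈ I ∧ m.degree r ≼[m] m.degree f ∧
      (∀ c ∈ r.support, c ∉ leadingExponents m (I : Set (MvPolynomial ι ℚ))) ∧
      reduceMod p (f - r) ∈ Ideal.span (reduceMod p '' std m I) := by
  have hφ : Function.Injective (integralSubring p).subtype := Subtype.val_injective
  obtain ⟨f, rfl⟩ := hf.exists_map
  -- The division takes place over the local ring: the divisors are monic, so their leading
  -- coefficients are units there too.
  obtain ⟨g, r, hfr, hdeg, hr⟩ := m.div_set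
    (B := {b : MvPolynomial ι (integralSubring p) | map (integralSubring p).subtype b ∈ std m I})
    (fun b hb => by
      have h1 := coeff_degree_of_mem_std m hb
      rw [degree_map_of_injective m hφ, coeff_map] at h1
      have h2 : m.leadingCoeff b = 1 := Subtype.ext h1
      rw [h2]
      exact isUnit_one) f
  have hsub : f - r = ∑ b ∈ g.support, g b * b := by
    rw [hfr, add_sub_cancel_right, Finsupp.linearCombination_apply, Finsupp.sum]
    simp only [smul_eq_mul]
  refine ⟨map (integralSubring p).subtype r, integralPoly_map r, ?_, ?_, ?_, ?_⟩
  · rw [← map_sub, hsub, map_sum]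
    refine Ideal.sum_mem _ fun b _ => ?_
    rw [map_mul]
    exact I.mul_mem_left _ b.2.1
  · rw [degree_map_of_injective m hφ, degree_map_of_injective m hφ]
    have : r = f - (f - r) := by ring
    rw [this]
    refine m.degree_sub_le.trans (sup_le le_rfl ?_)
    rw [hsub]
    refine m.degree_sum_le.trans (Finset.sup_le fun b _ => ?_)
    rw [mul_comm]
    exact hdeg b
  · intro c hc hcI
    obtain ⟨_, ⟨g, hg, -, rfl⟩, hle⟩ :=
      ((isGroebnerBasis_std m I).mem_leadingExponents_iff m).mp hcI
    obtain ⟨b, rfl⟩ := IntegralPoly.exists_map (hstd g hg)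
    rw [degree_map_of_injective m hφ] at hle
    refine hr c ?_ b hg hle
    rwa [support_map_of_injective r hφ] at hc
  · rw [← map_sub, reduceMod_map, hsub, map_sum]
    refine Ideal.sum_mem _ fun b _ => ?_
    rw [map_mul]
    refine Ideal.mul_mem_left _ _ (Ideal.subset_span ⟨_, b.2, ?_⟩)
    rw [reduceMod_map]

theorem reduceMod_mem_span_std [Finite ι] {I : Ideal (MvPolynomial ι ℚ)}
    (hstd : IntegralAt p (std m I)) {f : MvPolynomial ι ℚ} (hfI : f ∈ I)
    (hf : IntegralPoly p f) : reduceMod p f ∈ Ideal.span (reduceMod p '' std m I) := by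
  obtain ⟨r, -, hrI, -, hs, hspan⟩ := exists_integralPoly_remainder m hstd hf
  have hr : r ∈ I := by
    have := I.sub_mem hfI hrI
    rwa [sub_sub_cancel] at this
  have : r = 0 := eq_zero_of_support_notMem m (S := (I : Set (MvPolynomial ι ℚ))) hr hs
  rwa [this, sub_zero] at hspan

/-- If the reduced Gröbner basis of `I` is integral, then the leading monomial of the reduction
of an integral element of `I` is the leading monomial of an element of `I`. -/
theorem degree_reduceMod_mem [Finite ι] {I : Ideal (MvPolynomial ι ℚ)}
    (hstd : IntegralAt p (std m I)) {f : MvPolynomial ι ℚ} (hfI : f ∈ I)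
    (hfi : IntegralPoly p f) (h0 : reduceMod p f ≠ 0) :
    m.degree (reduceMod p f) ∈ leadingExponents m (I : Set (MvPolynomial ι ℚ)) := by
  classical
  by_contra hu
  set u := m.degree (reduceMod p f) with hu_def
  choose r hri hrI hrd hrs _ using fun s : ι →₀ ℕ =>
    exists_integralPoly_remainder m hstd
      (integralPoly_monomial (p := p) (integralSubring p).one_mem s)
  set T := f.support.filter (· ∈ leadingExponents m (I : Set (MvPolynomial ι ℚ))) with hT
  have hcoeff : ∀ s c, c ∈ leadingExponents m (I : Set (MvPolynomial ι ℚ)) →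
      coeff c (r s) = 0 := fun s c hc => by
    by_contra h
    exact hrs s c (mem_support_iff.mpr h) hc
  -- An element of `I` is determined by its coefficients at the leading exponents of `I`; `monomial
  -- s 1 - r s` is the element of `I` for which these single out `s`.
  have hf : f = ∑ s ∈ T, C (coeff s f) * (monomial s 1 - r s) := by
    rw [← sub_eq_zero]
    refine eq_zero_of_support_notMem m (S := (I : Set (MvPolynomial ι ℚ)))
      (I.sub_mem hfI (Ideal.sum_mem _ fun s _ => I.mul_mem_left _ (hrI s))) fun c hc hcI => ?_
    rw [mem_support_iff] at hc
    apply hc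
    rw [coeff_sub, coeff_sum]
    simp only [coeff_C_mul, coeff_sub, hcoeff _ c hcI, sub_zero, coeff_monomial, mul_ite, mul_one,
      mul_zero, Finset.sum_ite_eq']
    split_ifs with hcT
    · exact sub_self _
    · rw [sub_zero]
      by_contra h
      exact hcT (Finset.mem_filter.mpr ⟨mem_support_iff.mpr h, hcI⟩)
  have hmi : ∀ s : ι →₀ ℕ, IntegralPoly p (monomial s (1 : ℚ) - r s) := fun s =>
    (integralPoly_monomial (integralSubring p).one_mem s).sub (hri s)
  have huc : coeff u (reduceMod p f) ≠ 0 := m.coeff_degree_ne_zero_iff.mpr h0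
  have hf' := congrArg (fun q => coeff u (reduceMod p q)) hf
  rw [reduceMod_sum fun s _ => (hmi s).C_mul (hfi s), coeff_sum] at hf'
  rw [hf'] at huc
  refine huc (Finset.sum_eq_zero fun s hs => ?_)
  rw [reduceMod_C_mul (hmi s) (hfi s), coeff_C_mul]
  by_cases hs0 : reduceCoeff p (coeff s f) = 0
  · rw [hs0, zero_mul]
  -- A term surviving modulo `p` has `s` below `u`, and strictly since `u` is assumed not to be a
  -- leading exponent of `I`. As `r s` does not exceed `s`, this term contributes nothing at `u`.
  have hsu : s ≼[m] u := m.le_degree (by rwa [mem_support_iff, coeff_reduceMod])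
  have hsI := (Finset.mem_filter.mp hs).2
  have hne : s ≠ u := fun h => hu (h ▸ hsI)
  have hlt : s ≺[m] u := lt_of_le_of_ne hsu fun h => hne (m.toSyn.injective h)
  have hru : coeff u (r s) = 0 := m.coeff_eq_zero_of_lt
    (((hrd s).trans (m.degree_monomial_le _)).trans_lt hlt)
  rw [coeff_reduceMod, coeff_sub, coeff_monomial, if_neg hne, hru, sub_zero, reduceCoeff_zero,
    mul_zero]

end Lucky

/-! ### Statements valid for all but finitely many primes -/

section AlmostAll

open Filter

variable {ι : Type*}

theorem finite_setOf_dvd {d : ℕ} (hd : d ≠ 0) : {p : ℕ | p ∣ d}.Finite :=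
  (Set.finite_Iic d).subset fun _ hp => Nat.le_of_dvd (Nat.pos_of_ne_zero hd) hp

theorem eventually_integralPoly (f : MvPolynomial ι ℚ) :
    ∀ᶠ p : ℕ in cofinite, p.Prime → IntegralPoly p f := by
  have hfin : (⋃ b ∈ f.support, {p : ℕ | p ∣ (coeff b f).den}).Finite :=
    f.support.finite_toSet.biUnion fun b _ => finite_setOf_dvd (Rat.den_nz _)
  refine hfin.subset fun p hp => ?_
  simp only [Set.mem_compl_iff, Set.mem_ofPred_eq, Classical.not_imp, IntegralPoly, not_forall,
    not_not] at hp
  obtain ⟨hprime, b, hb⟩ := hp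
  refine Set.mem_biUnion (x := b) ?_ hb
  rw [Finset.mem_coe, mem_support_iff]
  intro h
  rw [h, Rat.den_zero] at hb
  exact hprime.one_lt.ne' (Nat.dvd_one.mp hb)

theorem eventually_integralAt {S : Set (MvPolynomial ι ℚ)} (hS : S.Finite) :
    ∀ᶠ p : ℕ in cofinite, p.Prime → IntegralAt p S := by
  have := (eventually_all_finite hS).mpr fun f _ => eventually_integralPoly f
  filter_upwards [this] with p hp hprime f hf
  exact hp f hf hprime

/-- A single expression of `g` through `F` involves finitely many denominators and can be reduced at
every other prime. -/
theorem eventually_reduceMod_mem {F : Set (MvPolynomial ι ℚ)} (hF : F.Finite)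
    {g : MvPolynomial ι ℚ} (hg : g ∈ Ideal.span F) :
    ∀ᶠ p : ℕ in cofinite, p.Prime → IntegralPoly p g ∧ reduceMod p g ∈ modIdeal p F := by
  induction hg using Submodule.span_induction with
  | mem x hx =>
    filter_upwards [eventually_integralAt hF] with p hp hprime
    exact ⟨hp hprime x hx, Ideal.subset_span ⟨x, hx, rfl⟩⟩
  | zero =>
    refine Eventually.of_forall fun p hprime => ?_
    have : Fact p.Prime := ⟨hprime⟩
    exact ⟨IntegralPoly.zero, by rw [reduceMod_zero]; exact Ideal.zero_mem _⟩
  | add x y _ _ hx hy =>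
    filter_upwards [hx, hy] with p hpx hpy hprime
    have : Fact p.Prime := ⟨hprime⟩
    obtain ⟨h1, h2⟩ := hpx hprime
    obtain ⟨h3, h4⟩ := hpy hprime
    exact ⟨h1.add h3, by rw [reduceMod_add h1 h3]; exact Ideal.add_mem _ h2 h4⟩
  | smul a x _ hx =>
    filter_upwards [hx, eventually_integralPoly a] with p hpx hpa hprime
    have : Fact p.Prime := ⟨hprime⟩
    obtain ⟨h1, h2⟩ := hpx hprime
    have h3 := hpa hprime
    exact ⟨h3.mul h1, by rw [smul_eq_mul, reduceMod_mul h3 h1]; exact Ideal.mul_mem_left _ _ h2⟩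

/-- For almost all primes, the leading monomials of `⟨F⟩` and of `⟨F mod p⟩` agree and the integral
elements of `⟨F⟩` reduce to elements of `⟨F mod p⟩`. -/
theorem eventually_leadingExponents_eq [Finite ι] (m : MonomialOrder ι)
    {F : Set (MvPolynomial ι ℚ)} (hF : F.Finite) :
    ∀ᶠ p : ℕ in cofinite, p.Prime → IntegralAt p F ∧
      leadingExponents m (Ideal.span F : Set (MvPolynomial ι ℚ)) =
        leadingExponents m (modIdeal p F : Set (MvPolynomial ι (ZMod p))) ∧
      ∀ f ∈ Ideal.span F, IntegralPoly p f → reduceMod p f ∈ modIdeal p F := by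
  -- Excluding finitely many primes for each of the finitely many elements of `std` is enough:
  -- division by this integral monic basis controls all other integral elements.
  have hstd := (eventually_all_finite (std_finite m (Ideal.span F))).mpr fun g hg =>
    eventually_reduceMod_mem hF (std_subset m _ hg)
  filter_upwards [hstd, eventually_integralAt hF] with p hp hpF hprime
  have : Fact p.Prime := ⟨hprime⟩
  have hint : IntegralAt p (std m (Ideal.span F)) := fun g hg => (hp g hg hprime).1
  have hle : Ideal.span (reduceMod p '' std m (Ideal.span F)) ≤ modIdeal p F := by
    rw [Ideal.span_le]
    rintro _ ⟨g, hg, rfl⟩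
    exact (hp g hg hprime).2
  refine ⟨hpF hprime, Set.Subset.antisymm ?_ ?_,
    fun f hf hfi => hle (reduceMod_mem_span_std m hint hf hfi)⟩
  · intro b hb
    obtain ⟨_, ⟨g, hg, -, rfl⟩, hab⟩ :=
      ((isGroebnerBasis_std m (Ideal.span F)).mem_leadingExponents_iff m).mp hb
    have h1 : reduceCoeff p (coeff (m.degree g) g) ≠ 0 := by
      rw [coeff_degree_of_mem_std m hg, reduceCoeff_one]
      exact one_ne_zero
    refine leadingExponents_upward m ⟨reduceMod p g, (hp g hg hprime).2, ?_,
      degree_reduceMod m h1⟩ hab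
    intro h
    rw [← coeff_reduceMod, h, coeff_zero] at h1
    exact h1 rfl
  · rintro _ ⟨w, hw, h0, rfl⟩
    obtain ⟨f, hf, hfi, rfl⟩ := exists_integralPoly_of_mem_modIdeal (hpF hprime) hw
    exact degree_reduceMod_mem m hint hf hfi h0

end AlmostAll

/-! ### Homogeneous ideals: dimensions of graded pieces under reduction -/

section Homogeneous

variable {ι : Type*}

theorem homogeneousComponent_mem_span {R : Type*} [CommRing R] {F : Set (MvPolynomial ι R)}
    (hF : ∀ f ∈ F, ∃ d, f.IsHomogeneous d) {f : MvPolynomial ι R} (hf : f ∈ Ideal.span F)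
    (d : ℕ) : homogeneousComponent d f ∈ Ideal.span F := by
  let := MvPolynomial.gradedAlgebra (σ := ι) (R := R)
  refine homogeneousComponent_mem_of_mem (Ideal.homogeneous_span _ F fun f hf => ?_) hf d
  obtain ⟨d, hd⟩ := hF f hf
  exact ⟨d, hd⟩

theorem isHomogeneous_reduceMod {f : MvPolynomial ι ℚ} {d : ℕ} (hf : f.IsHomogeneous d) (p : ℕ) :
    (reduceMod p f).IsHomogeneous d := by
  intro b hb
  refine hf fun h => hb ?_
  rw [coeff_reduceMod, h, reduceCoeff_zero]

theorem homogeneousComponent_mem_modIdeal {p : ℕ} {F : Set (MvPolynomial ι ℚ)}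
    (hF : ∀ f ∈ F, ∃ d, f.IsHomogeneous d) {f : MvPolynomial ι (ZMod p)} (hf : f ∈ modIdeal p F)
    (d : ℕ) : homogeneousComponent d f ∈ modIdeal p F := by
  refine homogeneousComponent_mem_span ?_ hf d
  rintro _ ⟨f, hf, rfl⟩
  obtain ⟨d, hd⟩ := hF f hf
  exact ⟨d, isHomogeneous_reduceMod hd p⟩

theorem reduceMod_homogeneousComponent (p d : ℕ) (f : MvPolynomial ι ℚ) :
    reduceMod p (homogeneousComponent d f) = homogeneousComponent d (reduceMod p f) := by
  ext b
  rw [coeff_reduceMod, coeff_homogeneousComponent, coeff_homogeneousComponent, coeff_reduceMod]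
  split_ifs
  · rfl
  · exact reduceCoeff_zero p

theorem IntegralPoly.homogeneousComponent {p : ℕ} [Fact p.Prime] {f : MvPolynomial ι ℚ}
    (hf : IntegralPoly p f) (d : ℕ) : IntegralPoly p (homogeneousComponent d f) := fun b => by
  rw [coeff_homogeneousComponent]
  split_ifs
  · exact hf b
  · exact (integralSubring p).zero_mem

theorem degree_homogeneousComponent {R : Type*} [CommRing R] (m : MonomialOrder ι)
    {f : MvPolynomial ι R} (h0 : f ≠ 0) :
    homogeneousComponent (m.degree f).degree f ≠ 0 ∧
      m.degree (homogeneousComponent (m.degree f).degree f) = m.degree f := by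
  have hc : coeff (m.degree f) (homogeneousComponent (m.degree f).degree f) ≠ 0 := by
    rw [coeff_homogeneousComponent, if_pos rfl]
    exact m.coeff_degree_ne_zero_iff.mpr h0
  refine ⟨fun h => hc (by rw [h, coeff_zero]), m.toSyn.injective (le_antisymm ?_ ?_)⟩
  · refine m.degree_le_iff.mpr fun b hb => m.le_degree ?_
    rw [mem_support_iff, coeff_homogeneousComponent] at hb
    rw [mem_support_iff]
    intro h
    simp [h] at hb
  · exact m.le_degree (mem_support_iff.mpr hc)

theorem linearIndependent_of_degree_injective {K κ : Type*} [Field K] (m : MonomialOrder ι)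
    {w : κ → MvPolynomial ι K} (h0 : ∀ s, w s ≠ 0)
    (hinj : Function.Injective fun s => m.degree (w s)) : LinearIndependent K w := by
  classical
  rw [linearIndependent_iff']
  intro T c hc
  by_contra! hne
  obtain ⟨i, hi, hci⟩ := hne
  obtain ⟨s, hs, hmax⟩ := Finset.exists_max_image (T.filter (c · ≠ 0))
    (fun s => m.toSyn (m.degree (w s))) ⟨i, Finset.mem_filter.mpr ⟨hi, hci⟩⟩
  rw [Finset.mem_filter] at hs
  have h1 := congrArg (coeff (m.degree (w s))) hc
  rw [coeff_zero, coeff_sum, Finset.sum_eq_single s] at h1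
  · rw [coeff_smul, smul_eq_mul, mul_eq_zero] at h1
    exact h1.elim hs.2 (m.coeff_degree_ne_zero_iff.mpr (h0 s))
  · intro t ht hts
    rw [coeff_smul, smul_eq_mul, mul_eq_zero, or_iff_not_imp_left]
    intro hct
    refine m.coeff_eq_zero_of_lt (lt_of_le_of_ne (hmax t (Finset.mem_filter.mpr ⟨ht, hct⟩)) ?_)
    exact fun h => hts (hinj (m.toSyn.injective h))
  · exact fun h => absurd hs.1 h

variable (m : MonomialOrder ι)

/-- The leading exponents of total degree `D`. -/
def leadingExponentsOfDegree {R : Type*} [CommRing R] (S : Set (MvPolynomial ι R)) (D : ℕ) :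
    Set (ι →₀ ℕ) := {a | a ∈ leadingExponents m S ∧ a.degree = D}

theorem leadingExponentsOfDegree_finite [Finite ι] {R : Type*} [CommRing R] (S : Set (MvPolynomial ι R))
    (D : ℕ) : (leadingExponentsOfDegree m S D).Finite :=
  (Finsupp.finite_of_degree_eq D).subset fun _ h => h.2

/-- Reading off the coefficients of the monomials of degree `D` which are leading monomials of
elements of `S`. -/
def leadingCoords {R : Type*} [CommRing R] (S : Set (MvPolynomial ι R)) (D : ℕ) :
    MvPolynomial ι R →ₗ[R] (leadingExponentsOfDegree m S D → R) :=
  LinearMap.pi fun a => lcoeff R (a : ι →₀ ℕ)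

/-- The leading coefficient of `f` would be one of its coordinates. So these coordinates embed the
degree `D` piece of `I` in a space whose dimension is a number of leading exponents. -/
theorem eq_zero_of_leadingCoords {K : Type*} [Field K] {I : Ideal (MvPolynomial ι K)} {D : ℕ}
    {f : MvPolynomial ι K} (hf : f ∈ I) (hD : f.IsHomogeneous D)
    (h : leadingCoords m (I : Set (MvPolynomial ι K)) D f = 0) : f = 0 := by
  by_contra h0
  have hd : (m.degree f).degree = D := by
    by_contra hne
    exact m.coeff_degree_ne_zero_iff.mpr h0 (hD.coeff_eq_zero hne)
  exact m.coeff_degree_ne_zero_iff.mpr h0 (congrFun h ⟨m.degree f, ⟨f, hf, h0, rfl⟩, hd⟩)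

variable {p : ℕ} [hp : Fact p.Prime] {F : Set (MvPolynomial ι ℚ)}

/-- A basis of the part of degree `D` of `⟨F mod p⟩` lifts to integral elements of `⟨F⟩`. -/
theorem exists_integral_family (hF : IntegralAt p F) (hhom : ∀ f ∈ F, ∃ d, f.IsHomogeneous d)
    (D : ℕ) :
    ∃ v : leadingExponentsOfDegree m (modIdeal p F : Set (MvPolynomial ι (ZMod p))) D →
        MvPolynomial ι ℚ,
      (∀ s, v s ∈ Ideal.span F ∧ (v s).IsHomogeneous D ∧ IntegralPoly p (v s) ∧
        reduceMod p (v s) ∈ modIdeal p F) ∧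
      LinearIndependent (ZMod p) fun s => reduceMod p (v s) := by
  have key : ∀ s : leadingExponentsOfDegree m (modIdeal p F : Set (MvPolynomial ι (ZMod p))) D,
      ∃ f : MvPolynomial ι ℚ, (f ∈ Ideal.span F ∧ f.IsHomogeneous D ∧ IntegralPoly p f ∧
        reduceMod p f ∈ modIdeal p F) ∧ reduceMod p f ≠ 0 ∧ m.degree (reduceMod p f) = s := by
    rintro ⟨_, ⟨w, hw, h0, rfl⟩, rfl⟩
    obtain ⟨f, hf, hfi, rfl⟩ := exists_integralPoly_of_mem_modIdeal hF hw
    refine ⟨homogeneousComponent (m.degree (reduceMod p f)).degree f,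
      ⟨homogeneousComponent_mem_span hhom hf _, homogeneousComponent_isHomogeneous _ _,
        hfi.homogeneousComponent _, ?_⟩, ?_⟩
    · rw [reduceMod_homogeneousComponent]
      exact homogeneousComponent_mem_modIdeal hhom hw _
    · rw [reduceMod_homogeneousComponent]
      exact degree_homogeneousComponent m h0
  choose v hv hv0 hvd using key
  refine ⟨v, hv, linearIndependent_of_degree_injective m hv0 fun s t h => ?_⟩
  simp only [hvd] at h
  exact Subtype.ext h

theorem linearIndependent_leadingCoords {κ : Type*} {I : Ideal (MvPolynomial ι ℚ)} {D : ℕ}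
    {v : κ → MvPolynomial ι ℚ} (hv : ∀ s, v s ∈ I ∧ (v s).IsHomogeneous D)
    (hli : LinearIndependent ℚ v) :
    LinearIndependent ℚ fun s => leadingCoords m (I : Set (MvPolynomial ι ℚ)) D (v s) := by
  rw [linearIndependent_iff'] at hli ⊢
  intro T c hc
  refine hli T c (eq_zero_of_leadingCoords m (I := I) (D := D) ?_ ?_ ?_)
  · exact Ideal.sum_mem _ fun s _ => by
      rw [smul_eq_C_mul]
      exact I.mul_mem_left _ (hv s).1
  · exact IsHomogeneous.sum _ _ _ fun s _ => by
      rw [smul_eq_C_mul]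
      exact (hv s).2.C_mul _
  · rw [map_sum]
    simpa only [map_smul] using hc

/-- Reduction modulo `p` of generators does not enlarge the dimensions of the graded parts of a
homogeneous ideal. -/
theorem ncard_leadingExponents_modIdeal_le [Finite ι] (hF : IntegralAt p F)
    (hhom : ∀ f ∈ F, ∃ d, f.IsHomogeneous d) (D : ℕ) :
    (leadingExponentsOfDegree m (modIdeal p F : Set (MvPolynomial ι (ZMod p))) D).ncard ≤
      (leadingExponentsOfDegree m (Ideal.span F : Set (MvPolynomial ι ℚ)) D).ncard := by
  obtain ⟨v, hv, hli⟩ := exists_integral_family m hF hhom D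
  have := (leadingExponentsOfDegree_finite m
    (modIdeal p F : Set (MvPolynomial ι (ZMod p))) D).fintype
  have := (leadingExponentsOfDegree_finite m (Ideal.span F : Set (MvPolynomial ι ℚ)) D).fintype
  have hli' := linearIndependent_leadingCoords m (I := Ideal.span F) (D := D)
    (fun s => ⟨(hv s).1, (hv s).2.1⟩)
    (linearIndependent_of_reduceMod (fun s => (hv s).2.2.1) hli)
  have := hli'.fintype_card_le_finrank
  rwa [Module.finrank_fintype_fun_eq_card, ← Nat.card_eq_fintype_card,
    ← Nat.card_eq_fintype_card] at this

/-- Modulo a lucky prime, the integral elements of a homogeneous ideal `⟨F⟩` reduce to elements of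
`⟨F mod p⟩`. -/
theorem reduceMod_mem_modIdeal_of_homogeneous [Finite ι] (hF : IntegralAt p F)
    (hhom : ∀ f ∈ F, ∃ d, f.IsHomogeneous d)
    (hLE : leadingExponents m (Ideal.span F : Set (MvPolynomial ι ℚ)) =
      leadingExponents m (modIdeal p F : Set (MvPolynomial ι (ZMod p))))
    {f : MvPolynomial ι ℚ} (hf : f ∈ Ideal.span F) (hfi : IntegralPoly p f) :
    reduceMod p f ∈ modIdeal p F := by
  suffices h : ∀ D : ℕ, reduceMod p (homogeneousComponent D f) ∈ modIdeal p F by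
    rw [← sum_homogeneousComponent f,
      reduceMod_sum fun D _ => hfi.homogeneousComponent D]
    exact Ideal.sum_mem _ fun D _ => h D
  intro D
  obtain ⟨v, hv, hli⟩ := exists_integral_family m hF hhom D
  have := (leadingExponentsOfDegree_finite m
    (modIdeal p F : Set (MvPolynomial ι (ZMod p))) D).fintype
  have := (leadingExponentsOfDegree_finite m (Ideal.span F : Set (MvPolynomial ι ℚ)) D).fintype
  have hli' := linearIndependent_leadingCoords m (I := Ideal.span F) (D := D)
    (fun s => ⟨(hv s).1, (hv s).2.1⟩)
    (linearIndependent_of_reduceMod (fun s => (hv s).2.2.1) hli)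
  -- Luckiness enters here: equal numbers of leading exponents in degree `D` turn the independent
  -- lifts into a basis.
  have hspan := hli'.span_eq_top_of_card_eq_finrank' (by
    rw [Module.finrank_fintype_fun_eq_card, ← Nat.card_eq_fintype_card,
      ← Nat.card_eq_fintype_card, leadingExponentsOfDegree, leadingExponentsOfDegree, hLE])
  have hmem : leadingCoords m (Ideal.span F : Set (MvPolynomial ι ℚ)) D
      (homogeneousComponent D f) ∈ Submodule.span ℚ (Set.range fun s =>
        leadingCoords m (Ideal.span F : Set (MvPolynomial ι ℚ)) D (v s)) := by
    rw [hspan]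
    exact Submodule.mem_top
  obtain ⟨c, hc⟩ := (Submodule.mem_span_range_iff_exists_fun ℚ).mp hmem
  have hfD := homogeneousComponent_mem_span hhom hf D
  have hsum : homogeneousComponent D f = ∑ s, C (c s) * v s := by
    rw [← sub_eq_zero]
    refine eq_zero_of_leadingCoords m (I := Ideal.span F) (D := D) ?_ ?_ ?_
    · exact Ideal.sub_mem _ hfD (Ideal.sum_mem _ fun s _ => Ideal.mul_mem_left _ _ (hv s).1)
    · exact (homogeneousComponent_isHomogeneous _ _).sub
        (IsHomogeneous.sum _ _ _ fun s _ => (hv s).2.1.C_mul _)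
    · rw [map_sub, map_sum, ← hc, sub_eq_zero]
      exact Finset.sum_congr rfl fun s _ => by rw [← smul_eq_C_mul, map_smul]
  have hint := hfi.homogeneousComponent D
  rw [hsum] at hint ⊢
  -- Independence modulo `p` makes the coefficients integral, so the relation itself can be reduced.
  have hcs := mem_integralSubring_of_linearIndependent (fun s => (hv s).2.2.1) hli c hint
  rw [reduceMod_sum fun s _ => (hv s).2.2.1.C_mul (hcs s)]
  refine Ideal.sum_mem _ fun s _ => ?_
  rw [reduceMod_C_mul (hv s).2.2.1 (hcs s)]
  exact Ideal.mul_mem_left _ _ (hv s).2.2.2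

end Homogeneous

/-! ### Misleading primes -/

section Misleading

variable {ι : Type*} [Finite ι] (m : MonomialOrder ι)

theorem isLucky_iff {F : Set (MvPolynomial ι ℚ)} {p : ℕ} [Fact p.Prime] :
    IsLucky m F p ↔ leadingExponents m (Ideal.span F : Set (MvPolynomial ι ℚ)) =
      leadingExponents m (modIdeal p F : Set (MvPolynomial ι (ZMod p))) :=
  leadingExponents_std_eq_iff m _ _

theorem eventually_isLucky {F : Set (MvPolynomial ι ℚ)} (hF : F.Finite) :
    ∀ᶠ p : ℕ in Filter.cofinite, p.Prime → IsLucky m F p := by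
  filter_upwards [eventually_leadingExponents_eq m hF] with p hp hprime
  have : Fact p.Prime := ⟨hprime⟩
  exact (isLucky_iff m).mpr (hp hprime).2.1

theorem finite_isMisleading {F : Set (MvPolynomial ι ℚ)} (hF : F.Finite) :
    {p : ℕ | IsMisleading m F p}.Finite := by
  refine (eventually_leadingExponents_eq m hF : Set.Finite _).subset fun p hp hgood => ?_
  obtain ⟨hprime, -, -, hbad⟩ := hp
  have : Fact p.Prime := ⟨hprime⟩
  exact hbad (reduceMod_image_std m (hgood hprime).2.2 (hgood hprime).2.1)

theorem not_isMisleading_of_homogeneous {F : Set (MvPolynomial ι ℚ)}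
    (hhom : ∀ f ∈ F, ∃ d, f.IsHomogeneous d) (p : ℕ) : ¬ IsMisleading m F p := by
  rintro ⟨hprime, hF, hlucky, hbad⟩
  have : Fact p.Prime := ⟨hprime⟩
  have hLE := (isLucky_iff m).mp hlucky
  exact hbad (reduceMod_image_std m
    (fun f => reduceMod_mem_modIdeal_of_homogeneous m hF hhom hLE) hLE)

end Misleading

/-! ### Homogenization and correctness of the final tests -/

section Homogenization

variable {ι K : Type*}

theorem homOrder_le_iff_of_degree_eq (m : MonomialOrder ι) {a b : Option ι →₀ ℕ}
    (h : a.degree = b.degree) : a ≼[homOrder m] b ↔ a.some ≼[m] b.some := by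
  rw [← not_lt, homOrder_lt_iff, ← not_lt]
  simp [h]

theorem optionElim_some_degree {a : Option ι →₀ ℕ} {d : ℕ} (h : a.degree = d) :
    a.some.optionElim (d - a.some.degree) = a := by
  rw [degree_option] at h
  ext o
  cases o with
  | none => simp; omega
  | some i => simp

theorem degree_optionElim {b : ι →₀ ℕ} {d : ℕ} (h : b.degree ≤ d) :
    (b.optionElim (d - b.degree)).degree = d := by
  rw [degree_option]
  simp
  omega

section CommRing

variable [CommRing K]

/-- Homogenization to degree `d` with respect to the additional variable `X none`. -/
def homogenizeTo (d : ℕ) (f : MvPolynomial ι K) : MvPolynomial (Option ι) K :=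
  ∑ b ∈ f.support, monomial (b.optionElim (d - b.degree)) (coeff b f)

theorem homogenize_eq (f : MvPolynomial ι K) : homogenize f = homogenizeTo f.totalDegree f := rfl

theorem coeff_homogenizeTo {d : ℕ} {f : MvPolynomial ι K} (h : ∀ b ∈ f.support, b.degree ≤ d)
    (a : Option ι →₀ ℕ) :
    coeff a (homogenizeTo d f) = if a.degree = d then coeff a.some f else 0 := by
  classical
  simp only [homogenizeTo, coeff_sum, coeff_monomial]
  split_ifs with ha
  · rw [Finset.sum_eq_single a.some, if_pos (optionElim_some_degree ha)]
    · intro b _ hb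
      rw [if_neg]
      rintro rfl
      exact hb (by simp)
    · intro hb
      rw [notMem_support_iff.mp hb, ite_self]
  · refine Finset.sum_eq_zero fun b hb => if_neg ?_
    rintro rfl
    exact ha (degree_optionElim (h b hb))

theorem isHomogeneous_homogenizeTo {d : ℕ} {f : MvPolynomial ι K}
    (h : ∀ b ∈ f.support, b.degree ≤ d) : (homogenizeTo d f).IsHomogeneous d :=
  IsHomogeneous.sum _ _ _ fun b hb => isHomogeneous_monomial _ (degree_optionElim (h b hb))

theorem degree_le_totalDegree (f : MvPolynomial ι K) : ∀ b ∈ f.support, b.degree ≤ f.totalDegree :=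
  fun _ hb => le_totalDegree hb

/-- Setting the additional variable `X none` to `1`. -/
def dehomogenize : MvPolynomial (Option ι) K →ₐ[K] MvPolynomial ι K :=
  aeval fun o : Option ι => o.elim 1 X

theorem dehomogenize_monomial (a : Option ι →₀ ℕ) (c : K) :
    dehomogenize (monomial a c) = monomial a.some c := by
  rw [dehomogenize, aeval_monomial, Finsupp.prod_option_index _ _ (by simp)
    (fun _ _ _ => pow_add _ _ _), monomial_eq]
  simp [algebraMap_eq]

theorem dehomogenize_X_none : dehomogenize (X none : MvPolynomial (Option ι) K) = 1 := by
  simp [dehomogenize]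

theorem dehomogenize_eq_sum (f : MvPolynomial (Option ι) K) :
    dehomogenize f = ∑ a ∈ f.support, monomial a.some (coeff a f) := by
  conv_lhs => rw [f.as_sum]
  rw [map_sum]
  exact Finset.sum_congr rfl fun a _ => dehomogenize_monomial _ _

theorem dehomogenize_homogenizeTo (d : ℕ) (f : MvPolynomial ι K) :
    dehomogenize (homogenizeTo d f) = f := by
  rw [homogenizeTo, map_sum]
  conv_rhs => rw [f.as_sum]
  refine Finset.sum_congr rfl fun b _ => ?_
  rw [dehomogenize_monomial, Finsupp.some_optionElim]

theorem dehomogenize_surjective :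
    Function.Surjective (dehomogenize : MvPolynomial (Option ι) K →ₐ[K] MvPolynomial ι K) :=
  -- Degree `0` suffices: truncated subtraction affects only the exponent of `t`, which is set to
  -- `1`.
  fun f => ⟨_, dehomogenize_homogenizeTo 0 f⟩

theorem coeff_dehomogenize {f : MvPolynomial (Option ι) K} {d : ℕ} (hf : f.IsHomogeneous d)
    {a : Option ι →₀ ℕ} (ha : a.degree = d) : coeff a.some (dehomogenize f) = coeff a f := by
  classical
  rw [dehomogenize_eq_sum, coeff_sum]
  simp only [coeff_monomial]
  rw [Finset.sum_eq_single a, if_pos rfl]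
  · intro b hb hba
    rw [if_neg]
    intro h
    have hbd : b.degree = d := by
      by_contra hne
      exact mem_support_iff.mp hb (hf.coeff_eq_zero hne)
    exact hba (by rw [← optionElim_some_degree hbd, h, optionElim_some_degree ha])
  · intro h
    rw [notMem_support_iff.mp h, ite_self]

theorem exists_of_mem_support_dehomogenize {f : MvPolynomial (Option ι) K} {c : ι →₀ ℕ}
    (hc : c ∈ (dehomogenize f).support) : ∃ a ∈ f.support, a.some = c := by
  classical
  by_contra! h
  rw [mem_support_iff, dehomogenize_eq_sum, coeff_sum] at hc
  refine hc (Finset.sum_eq_zero fun a ha => ?_)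
  rw [coeff_monomial, if_neg (h a ha)]

theorem eq_of_dehomogenize_eq {f g : MvPolynomial (Option ι) K} {d : ℕ}
    (hf : f.IsHomogeneous d) (hg : g.IsHomogeneous d) (h : dehomogenize f = dehomogenize g) :
    f = g := by
  ext a
  by_cases ha : a.degree = d
  · rw [← coeff_dehomogenize hf ha, h, coeff_dehomogenize hg ha]
  · rw [hf.coeff_eq_zero ha, hg.coeff_eq_zero ha]

theorem degree_of_mem_support {f : MvPolynomial ι K} {d : ℕ} (hf : f.IsHomogeneous d)
    {a : ι →₀ ℕ} (ha : a ∈ f.support) : a.degree = d := by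
  by_contra hne
  exact mem_support_iff.mp ha (hf.coeff_eq_zero hne)

theorem degree_dehomogenize (m : MonomialOrder ι) {f : MvPolynomial (Option ι) K} {d : ℕ}
    (hf : f.IsHomogeneous d) (h0 : f ≠ 0) :
    dehomogenize f ≠ 0 ∧ m.degree (dehomogenize f) = ((homOrder m).degree f).some := by
  have hmem := (homOrder m).degree_mem_support h0
  have hd := degree_of_mem_support hf hmem
  have hc : coeff ((homOrder m).degree f).some (dehomogenize f) ≠ 0 := by
    rw [coeff_dehomogenize hf hd]
    exact mem_support_iff.mp hmem
  refine ⟨fun h => hc (by rw [h, coeff_zero]), m.toSyn.injective (le_antisymm ?_ ?_)⟩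
  · refine m.degree_le_iff.mpr fun c hc => ?_
    obtain ⟨a, ha, rfl⟩ := exists_of_mem_support_dehomogenize hc
    rw [← homOrder_le_iff_of_degree_eq m ((degree_of_mem_support hf ha).trans hd.symm)]
    exact (homOrder m).le_degree ha
  · exact m.le_degree (mem_support_iff.mpr hc)

theorem map_dehomogenize_span (F : Set (MvPolynomial ι K)) :
    (Ideal.span (homogenize '' F)).map (dehomogenize (K := K)) = Ideal.span F := by
  rw [Ideal.map_span, Set.image_image]
  simp only [homogenize_eq, dehomogenize_homogenizeTo, Set.image_id']

theorem isHomogeneous_of_mem_homogenize {F : Set (MvPolynomial ι K)} :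
    ∀ f ∈ homogenize '' F, ∃ d, f.IsHomogeneous d := by
  rintro _ ⟨f, -, rfl⟩
  exact ⟨_, isHomogeneous_homogenizeTo (degree_le_totalDegree f)⟩

/-- Homogenizing an element of the dehomogenization of a homogeneous ideal `J` gives an element of
`(J : t^∞)`. -/
theorem exists_X_pow_mul_homogenizeTo_mem {J : Ideal (MvPolynomial (Option ι) K)}
    (hJ : ∀ f ∈ J, ∀ d, homogeneousComponent d f ∈ J) {g : MvPolynomial ι K}
    (hg : g ∈ J.map (dehomogenize (K := K))) {d : ℕ} (hd : ∀ b ∈ g.support, b.degree ≤ d) :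
    ∃ j, (X none : MvPolynomial (Option ι) K) ^ j * homogenizeTo d g ∈ J := by
  obtain ⟨w, hw, rfl⟩ := (Ideal.mem_map_iff_of_surjective _ dehomogenize_surjective).mp hg
  set D := max d w.totalDegree with hD
  -- Padding the components of `w` by powers of `t` gives a form of degree `D` in `J`. It agrees
  -- with `t ^ (D - d) * homogenizeTo d g`, as forms of equal degree are determined by their values
  -- at `t = 1`.
  have hWmem : ∑ i ∈ Finset.range (w.totalDegree + 1),
      (X none : MvPolynomial (Option ι) K) ^ (D - i) * homogeneousComponent i w ∈ J :=
    J.sum_mem fun i _ => J.mul_mem_left _ (hJ w hw i)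
  refine ⟨D - d, ?_⟩
  convert hWmem using 1
  refine eq_of_dehomogenize_eq (d := D) ?_ ?_ ?_
  · have := ((isHomogeneous_X K (none : Option ι)).pow (D - d)).mul
      (isHomogeneous_homogenizeTo hd)
    rwa [one_mul, Nat.sub_add_cancel (le_max_left _ _)] at this
  · refine IsHomogeneous.sum _ _ _ fun i hi => ?_
    have := ((isHomogeneous_X K (none : Option ι)).pow (D - i)).mul
      (homogeneousComponent_isHomogeneous i w)
    have hi' := Finset.mem_range.mp hi
    rwa [one_mul, Nat.sub_add_cancel ((Nat.lt_succ_iff.mp hi').trans (le_max_right _ _))] at this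
  · rw [map_mul, map_pow, dehomogenize_X_none, one_pow, one_mul, dehomogenize_homogenizeTo, map_sum]
    simp only [map_mul, map_pow, dehomogenize_X_none, one_pow, one_mul]
    rw [← map_sum, sum_homogeneousComponent]

theorem coeff_X_none_pow_mul (e : ℕ) (f : MvPolynomial (Option ι) K) {a : Option ι →₀ ℕ}
    (ha : a none < e) : coeff a ((X none : MvPolynomial (Option ι) K) ^ e * f) = 0 := by
  classical
  rw [X_pow_eq_monomial, coeff_monomial_mul', if_neg]
  intro h
  have := h none
  simp at this
  omega

end CommRing

/-- Reduction may lower the total degree, so the reduction of `f^h` is a homogenization to the old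
degree `f.totalDegree`, possibly with extra factors `t`. -/
theorem reduceMod_homogenize (p : ℕ) (f : MvPolynomial ι ℚ) :
    dehomogenize (reduceMod p (homogenize f)) = reduceMod p f := by
  have h := degree_le_totalDegree f
  have h' : ∀ b ∈ (reduceMod p f).support, b.degree ≤ f.totalDegree := fun b hb =>
    h b (support_reduceMod_subset p f hb)
  have : reduceMod p (homogenize f) = homogenizeTo f.totalDegree (reduceMod p f) := by
    ext a
    rw [coeff_reduceMod, homogenize_eq, coeff_homogenizeTo h, coeff_homogenizeTo h',
      coeff_reduceMod]
    split_ifs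
    · rfl
    · exact reduceCoeff_zero p
  rw [this, dehomogenize_homogenizeTo]

theorem map_dehomogenize_modIdeal (p : ℕ) (F : Set (MvPolynomial ι ℚ)) :
    (modIdeal p (homogenize '' F)).map (dehomogenize (K := ZMod p)) = modIdeal p F := by
  rw [modIdeal, modIdeal, Ideal.map_span, Set.image_image, Set.image_image]
  simp only [reduceMod_homogenize]

theorem modIdeal_union_X_pow (p e : ℕ) (F : Set (MvPolynomial (Option ι) ℚ)) :
    modIdeal p (F ∪ {(X none : MvPolynomial (Option ι) ℚ) ^ e}) =
      modIdeal p F ⊔ Ideal.span {(X none : MvPolynomial (Option ι) (ZMod p)) ^ e} := by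
  rw [modIdeal, modIdeal, Set.image_union, Ideal.span_union, Set.image_singleton,
    X_pow_eq_monomial, reduceMod_monomial, reduceCoeff_one, X_pow_eq_monomial]

theorem degree_le_of_le {m : MonomialOrder ι} (hm : ∀ a b : ι →₀ ℕ, a.degree < b.degree → a ≺[m] b)
    {a b : ι →₀ ℕ} (h : a ≼[m] b) : a.degree ≤ b.degree := by
  by_contra! hlt
  exact (hm _ _ hlt).not_ge h

variable [Field K] (m : MonomialOrder ι)

/-- For a homogeneous ideal `J`, the leading monomials of `J + ⟨t^e⟩` are those of `J` and the
multiples of `t^e`. -/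
theorem mem_leadingExponents_sup_X_pow (hm : ∀ a b : ι →₀ ℕ, a.degree < b.degree → a ≺[m] b)
    {J : Ideal (MvPolynomial (Option ι) K)}
    (hJ : ∀ f ∈ J, ∀ d, homogeneousComponent d f ∈ J) (e : ℕ) (a : Option ι →₀ ℕ) :
    a ∈ leadingExponents (homOrder m)
        ((J ⊔ Ideal.span {(X none : MvPolynomial (Option ι) K) ^ e} :
          Ideal (MvPolynomial (Option ι) K)) : Set (MvPolynomial (Option ι) K)) ↔
      a ∈ leadingExponents (homOrder m) (J : Set (MvPolynomial (Option ι) K)) ∨ e ≤ a none := by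
  classical
  constructor
  · rintro ⟨f, hf, h0, rfl⟩
    rw [or_iff_not_imp_right, not_le]
    intro hlt
    obtain ⟨j, hj, q, hq, rfl⟩ := Submodule.mem_sup.mp hf
    obtain ⟨q, rfl⟩ := Ideal.mem_span_singleton'.mp hq
    set a := (homOrder m).degree (j + q * X none ^ e) with ha
    have hq0 : ∀ b : Option ι →₀ ℕ, b none < e → coeff b (q * X none ^ e) = 0 := fun b hb => by
      rw [mul_comm]
      exact coeff_X_none_pow_mul e q hb
    have haj : coeff a j ≠ 0 := by
      have := (homOrder m).coeff_degree_ne_zero_iff.mpr h0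
      rwa [← ha, coeff_add, hq0 a hlt, add_zero] at this
    have hcomp : coeff a (homogeneousComponent a.degree j) ≠ 0 := by
      rwa [coeff_homogeneousComponent, if_pos rfl]
    refine ⟨_, hJ j hj a.degree, fun h => hcomp (by rw [h, coeff_zero]),
      (homOrder m).toSyn.injective (le_antisymm ?_ ?_)⟩
    · refine (homOrder m).degree_le_iff.mpr fun b hb => ?_
      have hbd := degree_of_mem_support (homogeneousComponent_isHomogeneous _ _) hb
      rw [mem_support_iff, coeff_homogeneousComponent, if_pos hbd] at hb
      rcases lt_or_ge (b none) e with hbe | hbe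
      · refine (homOrder m).le_degree (mem_support_iff.mpr ?_)
        rwa [coeff_add, hq0 b hbe, add_zero]
      -- At equal total degree, more factors `t` mean lower degree in the original variables, so
      -- multiples of `t^e` lie below `a`. Here the degree ordering is essential.
      · rw [homOrder_le_iff_of_degree_eq m hbd]
        refine (hm _ _ ?_).le
        rw [degree_option, degree_option] at hbd
        omega
    · exact (homOrder m).le_degree (mem_support_iff.mpr hcomp)
  · rintro (h | h)
    · exact leadingExponents_mono _ (SetLike.coe_subset_coe.mpr le_sup_left) h
    · refine leadingExponents_upward _ (a := Finsupp.single none e)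
        ⟨X none ^ e, Ideal.mem_sup_right (Ideal.mem_span_singleton_self _),
          pow_ne_zero _ (X_ne_zero _), ?_⟩ ?_
      · rw [X_pow_eq_monomial, MonomialOrder.degree_monomial, if_neg one_ne_zero]
      · rwa [Finsupp.single_le_iff]

theorem isLucky_union_X_pow_iff [Finite ι]
    (hm : ∀ a b : ι →₀ ℕ, a.degree < b.degree → a ≺[m] b)
    {F : Set (MvPolynomial (Option ι) ℚ)} (hF : ∀ f ∈ F, ∃ d, f.IsHomogeneous d) {p : ℕ}
    [Fact p.Prime] (e : ℕ) :
    IsLucky (homOrder m) (F ∪ {(X none : MvPolynomial (Option ι) ℚ) ^ e}) p ↔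
      ∀ a : Option ι →₀ ℕ, a none < e →
        (a ∈ leadingExponents (homOrder m) (Ideal.span F : Set (MvPolynomial (Option ι) ℚ)) ↔
          a ∈ leadingExponents (homOrder m)
            (modIdeal p F : Set (MvPolynomial (Option ι) (ZMod p)))) := by
  rw [isLucky_iff, modIdeal_union_X_pow, Ideal.span_union, Set.ext_iff]
  refine forall_congr' fun a => ?_
  rw [mem_leadingExponents_sup_X_pow m hm (fun f hf d => homogeneousComponent_mem_span hF hf d),
    mem_leadingExponents_sup_X_pow m hm
      (fun f hf d => homogeneousComponent_mem_modIdeal hF hf d)]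
  by_cases h : e ≤ a none
  · simp [h]
  · simp [h, not_le.mp h]

/-- The exceptional primes must not depend on `e`, which is chosen after the test prime. Equality of
leading monomials for `F` alone settles every `e` at once. -/
theorem eventually_isLucky_union_X_pow [Finite ι]
    (hm : ∀ a b : ι →₀ ℕ, a.degree < b.degree → a ≺[m] b)
    {F : Set (MvPolynomial (Option ι) ℚ)} (hfin : F.Finite)
    (hF : ∀ f ∈ F, ∃ d, f.IsHomogeneous d) :
    ∀ᶠ p : ℕ in Filter.cofinite, p.Prime → ∀ e : ℕ,
      IsLucky (homOrder m) (F ∪ {(X none : MvPolynomial (Option ι) ℚ) ^ e}) p := by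
  filter_upwards [eventually_leadingExponents_eq (homOrder m) hfin] with p hp hprime e
  have : Fact p.Prime := ⟨hprime⟩
  rw [isLucky_union_X_pow_iff m hm hF, (hp hprime).2.1]
  exact fun _ _ => Iff.rfl

/-- The leading exponents of total degree at most `d`. -/
def leadingExponentsUpTo {R : Type*} [CommRing R] (S : Set (MvPolynomial ι R)) (d : ℕ) :
    Set (ι →₀ ℕ) := {a | a ∈ leadingExponents m S ∧ a.degree ≤ d}

theorem leadingExponentsUpTo_finite [Finite ι] {R : Type*} [CommRing R]
    (S : Set (MvPolynomial ι R)) (d : ℕ) : (leadingExponentsUpTo m S d).Finite :=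
  (Finsupp.finite_of_degree_le d).subset fun _ h => h.2

variable {J : Ideal (MvPolynomial (Option ι) K)}

theorem some_mem_leadingExponentsUpTo (hJ : ∀ f ∈ J, ∀ d, homogeneousComponent d f ∈ J)
    {d e : ℕ} {a : Option ι →₀ ℕ}
    (ha : a ∈ leadingExponentsOfDegree (homOrder m) (J : Set (MvPolynomial (Option ι) K)) (d + e))
    (hae : e ≤ a none) :
    a.some ∈ leadingExponentsUpTo m
      (J.map (dehomogenize (K := K)) : Set (MvPolynomial ι K)) d := by
  obtain ⟨⟨f, hf, h0, rfl⟩, hd⟩ := ha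
  obtain ⟨h1, h2⟩ := degree_homogeneousComponent (homOrder m) h0
  obtain ⟨h3, h4⟩ := degree_dehomogenize m (homogeneousComponent_isHomogeneous _ f) h1
  refine ⟨⟨_, Ideal.mem_map_of_mem _ (hJ f hf _), h3, ?_⟩, ?_⟩
  · rw [h4, h2]
  · rw [degree_option] at hd
    omega

/-- For a degree ordering, a bound on the leading monomial bounds all of `g`, which can thus be
homogenized to degree `d`; saturation then puts its multiple by `t^e` in `J`. -/
theorem exists_some_eq_of_mem_leadingExponentsUpTo
    (hm : ∀ a b : ι →₀ ℕ, a.degree < b.degree → a ≺[m] b)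
    (hJ : ∀ f ∈ J, ∀ d, homogeneousComponent d f ∈ J) {d e : ℕ}
    (he : IsSaturationExponent J e) {b : ι →₀ ℕ}
    (hb : b ∈ leadingExponentsUpTo m
      (J.map (dehomogenize (K := K)) : Set (MvPolynomial ι K)) d) :
    ∃ a ∈ leadingExponentsOfDegree (homOrder m) (J : Set (MvPolynomial (Option ι) K)) (d + e),
      e ≤ a none ∧ a.some = b := by
  obtain ⟨⟨g, hg, h0, rfl⟩, hd⟩ := hb
  have hgd : ∀ b ∈ g.support, b.degree ≤ d := fun b hb =>
    (degree_le_of_le hm (m.le_degree hb)).trans hd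
  obtain ⟨j, hj⟩ := exists_X_pow_mul_homogenizeTo_mem hJ hg hgd
  have hmem := he j _ hj
  have hhom := isHomogeneous_homogenizeTo hgd
  have hG0 : homogenizeTo d g ≠ 0 := fun h => h0 (by
    rw [← dehomogenize_homogenizeTo d g, h, map_zero])
  have hX0 : (X none : MvPolynomial (Option ι) K) ^ e ≠ 0 := pow_ne_zero _ (X_ne_zero _)
  have hdeg : (homOrder m).degree ((X none : MvPolynomial (Option ι) K) ^ e * homogenizeTo d g) =
      Finsupp.single none e + (homOrder m).degree (homogenizeTo d g) := by
    rw [(homOrder m).degree_mul hX0 hG0, X_pow_eq_monomial]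
    classical
    rw [MonomialOrder.degree_monomial, if_neg one_ne_zero]
  refine ⟨_, ⟨⟨_, hmem, mul_ne_zero hX0 hG0, rfl⟩, ?_⟩, ?_, ?_⟩
  · rw [hdeg, map_add, degree_of_mem_support hhom ((homOrder m).degree_mem_support hG0),
      Finsupp.degree_single, add_comm]
  · rw [hdeg]
    simp
  · have h4 := (degree_dehomogenize m hhom hG0).2
    rw [dehomogenize_homogenizeTo] at h4
    rw [hdeg, Finsupp.some_add, ← h4]
    simp

/-- The test on luckiness guarantees that the affine Hilbert function of `⟨F⟩` is at least the one
of `⟨F mod p⟩`. -/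
theorem ncard_leadingExponentsUpTo_le [Finite ι]
    (hm : ∀ a b : ι →₀ ℕ, a.degree < b.degree → a ≺[m] b) {F : Set (MvPolynomial ι ℚ)} {p e : ℕ}
    [hp : Fact p.Prime] (hF : IntegralAt p F)
    (he : IsSaturationExponent (modIdeal p (homogenize '' F)) e)
    (hlucky : IsLucky (homOrder m)
      (homogenize '' F ∪ {(X none : MvPolynomial (Option ι) ℚ) ^ e}) p) (d : ℕ) :
    (leadingExponentsUpTo m (modIdeal p F : Set (MvPolynomial ι (ZMod p))) d).ncard ≤
      (leadingExponentsUpTo m (Ideal.span F : Set (MvPolynomial ι ℚ)) d).ncard := by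
  have hhom := isHomogeneous_of_mem_homogenize (F := F)
  have hFh : IntegralAt p (homogenize '' F) := by
    rintro _ ⟨f, hf, rfl⟩ b
    rw [homogenize_eq, coeff_homogenizeTo (degree_le_totalDegree f)]
    split_ifs
    · exact hF f hf _
    · exact (integralSubring p).zero_mem
  rw [isLucky_union_X_pow_iff m hm hhom] at hlucky
  set T : Set (Option ι →₀ ℕ) := {a | e ≤ a none}
  set S := leadingExponentsOfDegree (homOrder m)
    (Ideal.span (homogenize '' F) : Set (MvPolynomial (Option ι) ℚ)) (d + e) with hS
  set Sp := leadingExponentsOfDegree (homOrder m)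
    (modIdeal p (homogenize '' F) : Set (MvPolynomial (Option ι) (ZMod p))) (d + e) with hSp
  have hSfin : S.Finite := leadingExponentsOfDegree_finite _ _ _
  have hSpfin : Sp.Finite := leadingExponentsOfDegree_finite _ _ _
  have hle : Sp.ncard ≤ S.ncard := ncard_leadingExponents_modIdeal_le _ hFh hhom _
  have hdiff : S \ T = Sp \ T := by
    ext a
    refine ⟨fun ⟨h, hT⟩ => ⟨⟨?_, h.2⟩, hT⟩, fun ⟨h, hT⟩ => ⟨⟨?_, h.2⟩, hT⟩⟩
    · exact (hlucky a (not_le.mp hT)).mp h.1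
    · exact (hlucky a (not_le.mp hT)).mpr h.1
  have h1 := Set.ncard_inter_add_ncard_sdiff_eq_ncard S T hSfin
  have h2 := Set.ncard_inter_add_ncard_sdiff_eq_ncard Sp T hSpfin
  rw [hdiff] at h1
  -- The parts outside `T` coincide by the luckiness test and cancel from `hle`.
  have h3 : (Sp ∩ T).ncard ≤ (S ∩ T).ncard := by omega
  have h4 : (S ∩ T).ncard ≤
      (leadingExponentsUpTo m (Ideal.span F : Set (MvPolynomial ι ℚ)) d).ncard := by
    refine Set.ncard_le_ncard_of_injOn Finsupp.some ?_ ?_ (leadingExponentsUpTo_finite m _ d)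
    · rintro a ⟨ha, hT⟩
      rw [← map_dehomogenize_span F]
      exact some_mem_leadingExponentsUpTo m
        (fun f hf d => homogeneousComponent_mem_span hhom hf d) ha hT
    · rintro a ⟨ha, -⟩ b ⟨hb, -⟩ hab
      rw [← optionElim_some_degree ha.2, hab, optionElim_some_degree hb.2]
  have h5 : (leadingExponentsUpTo m (modIdeal p F : Set (MvPolynomial ι (ZMod p))) d).ncard ≤
      (Sp ∩ T).ncard := by
    refine le_trans (Set.ncard_le_ncard ?_ ((hSpfin.inter_of_left T).image Finsupp.some))
      (Set.ncard_image_le (hSpfin.inter_of_left T))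
    intro b hb
    rw [← map_dehomogenize_modIdeal] at hb
    obtain ⟨a, ha, hae, rfl⟩ := exists_some_eq_of_mem_leadingExponentsUpTo m hm
      (fun f hf d => homogeneousComponent_mem_modIdeal hhom hf d) he hb
    exact ⟨a, ⟨ha, hae⟩, rfl⟩
  exact h5.trans (h3.trans h4)

theorem UnitAt.integralAt {F : Set (MvPolynomial ι ℚ)} {p : ℕ} [hp : Fact p.Prime]
    (h : UnitAt p F) : IntegralAt p F := by
  intro f hf b
  by_cases hb : b ∈ f.support
  · exact (h f hf b hb).2
  · rw [notMem_support_iff.mp hb]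
    exact (integralSubring p).zero_mem

theorem UnitAt.reduceCoeff_ne_zero {F : Set (MvPolynomial ι ℚ)} {p : ℕ} [hp : Fact p.Prime]
    (h : UnitAt p F) {f : MvPolynomial ι ℚ} (hf : f ∈ F) {b : ι →₀ ℕ} (hb : b ∈ f.support) :
    reduceCoeff p (coeff b f) ≠ 0 := by
  obtain ⟨h1, h2⟩ := h f hf b hb
  rw [reduceCoeff]
  refine mul_ne_zero ?_ (inv_ne_zero (natCast_den_ne_zero h2))
  rwa [Ne, ZMod.intCast_zmod_eq_zero_iff_dvd, Int.natCast_dvd]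

theorem UnitAt.leadingExponents_reduceMod {G : Set (MvPolynomial ι ℚ)} {p : ℕ}
    [hp : Fact p.Prime] (h : UnitAt p G) :
    leadingExponents m (reduceMod p '' G) = leadingExponents m G := by
  ext a
  constructor
  · rintro ⟨_, ⟨g, hg, rfl⟩, h0, rfl⟩
    have hg0 : g ≠ 0 := by
      rintro rfl
      exact h0 (reduceMod_zero p)
    exact ⟨g, hg, hg0,
      (degree_reduceMod m (h.reduceCoeff_ne_zero hg (m.degree_mem_support hg0))).symm⟩
  · rintro ⟨g, hg, hg0, rfl⟩
    have h1 := h.reduceCoeff_ne_zero hg (m.degree_mem_support hg0)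
    refine ⟨_, ⟨g, hg, rfl⟩, ?_, degree_reduceMod m h1⟩
    intro h2
    rw [← coeff_reduceMod, h2, coeff_zero] at h1
    exact h1 rfl

/-- A set which passes the final verification tests is a Gröbner basis of `⟨F⟩`. -/
theorem FinalVerification.isGroebnerBasis [Finite ι]
    (hm : ∀ a b : ι →₀ ℕ, a.degree < b.degree → a ≺[m] b) {F G : Set (MvPolynomial ι ℚ)}
    {p e : ℕ} (hp : p.Prime) (hF : UnitAt p F) (hG : UnitAt p G)
    (he : IsSaturationExponent (modIdeal p (homogenize '' F)) e)
    (h : FinalVerification m F p e G) : IsGroebnerBasis m G (Ideal.span F) := by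
  have : Fact p.Prime := ⟨hp⟩
  have hLE : leadingExponents m (Ideal.span G : Set (MvPolynomial ι ℚ)) =
      leadingExponents m (modIdeal p F : Set (MvPolynomial ι (ZMod p))) := by
    ext b
    rw [h.self.mem_leadingExponents_iff, h.modular.mem_leadingExponents_iff,
      hG.leadingExponents_reduceMod]
  have hspan : Ideal.span F = Ideal.span G := by
    refine le_antisymm h.input_le (le_of_leadingExponents_subset m h.input_le fun b hb => ?_)
    have hsub : leadingExponentsUpTo m (Ideal.span F : Set (MvPolynomial ι ℚ)) b.degree ⊆
        leadingExponentsUpTo m (Ideal.span G : Set (MvPolynomial ι ℚ)) b.degree := fun c hc =>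
      ⟨leadingExponents_mono m (SetLike.coe_subset_coe.mpr h.input_le) hc.1, hc.2⟩
    have hcard := ncard_leadingExponentsUpTo_le m hm hF.integralAt he h.lucky b.degree
    -- The inclusion bounds the count for `⟨F⟩` by that for `⟨G⟩`, which is the count for `I_p` and
    -- so at most that for `⟨F⟩`: all are equal.
    have heq := Set.eq_of_subset_of_ncard_le hsub (by
      rw [leadingExponentsUpTo, hLE]
      exact hcard) (leadingExponentsUpTo_finite m _ _)
    have hb' : b ∈ leadingExponentsUpTo m (Ideal.span G : Set (MvPolynomial ι ℚ)) b.degree :=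
      ⟨hb, le_rfl⟩
    rw [← heq] at hb'
    exact hb'.1
  rw [hspan]
  exact h.self

end Homogenization

/-! ### Invertibility of `τ` -/

section Eigenforms

variable {n : ℕ} {σ : Equiv.Perm (Fin n)}

theorem CycleDecomposition.pow_entry (d : CycleDecomposition σ) (c : Fin d.num)
    (i : Fin (d.len c)) (j : ℕ) :
    (σ ^ j) (d.entry ⟨c, i⟩) =
      d.entry ⟨c, ⟨((i : ℕ) + j) % d.len c, Nat.mod_lt _ (d.len_pos c)⟩⟩ := by
  induction j with
  | zero => simp [Nat.mod_eq_of_lt i.2]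
  | succ j ih =>
    have : NeZero (d.len c) := ⟨(d.len_pos c).ne'⟩
    rw [pow_succ', Equiv.Perm.mul_apply, ih, d.map_entry, finRotate_apply]
    congr 2
    apply Fin.ext
    rw [Fin.val_add, Fin.val_one', Nat.mod_add_mod, Nat.add_mod_mod, add_assoc]

theorem CycleDecomposition.len_dvd_orderOf (d : CycleDecomposition σ) (c : Fin d.num) :
    d.len c ∣ orderOf σ := by
  have h := d.pow_entry c ⟨0, d.len_pos c⟩ (orderOf σ)
  rw [pow_orderOf_eq_one, Equiv.Perm.one_apply] at h
  have h2 := d.entry.injective h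
  simp only [Sigma.mk.injEq, heq_eq_eq, true_and, Fin.mk.injEq, zero_add] at h2
  exact Nat.dvd_of_mod_eq_zero h2.symm

variable {K : Type*} [Field K]

/-- Up to a scalar, the eigenforms attached to a cycle are given by a Vandermonde matrix. -/
theorem C_mul_eigenform_entry (d : CycleDecomposition σ) {ξ : K} {c : Fin d.num}
    (hξ : (ξ ^ (orderOf σ / d.len c)) ^ d.len c = 1) (i : Fin (d.len c)) :
    C ((ξ ^ (orderOf σ / d.len c)) ^ ((i : ℕ) * (i : ℕ))) * eigenform d ξ (d.entry ⟨c, i⟩) =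
      ∑ j : Fin (d.len c), C ((ξ ^ (orderOf σ / d.len c)) ^ ((i : ℕ) * (j : ℕ))) *
        X (d.entry ⟨c, j⟩) := by
  have : NeZero (d.len c) := ⟨(d.len_pos c).ne'⟩
  have h : eigenform d ξ (d.entry ⟨c, i⟩) = ∑ j : Fin (d.len c),
      C ((ξ ^ (orderOf σ / d.len c)) ^ ((i : ℕ) * (j : ℕ))) *
        X ((σ ^ (j : ℕ)) (d.entry ⟨c, i⟩)) := by
    unfold eigenform
    rw [Equiv.symm_apply_apply]
  rw [h, Finset.mul_sum]
  -- The eigenform counts from position `i`, so its `j`-th variable sits at position `i + j`; the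
  -- factor `ζ^(i * i)` completes `ζ^(i * j)` to `ζ^(i * (i + j))`.
  conv_rhs => rw [← Equiv.sum_comp (Equiv.addLeft i)]
  refine Finset.sum_congr rfl fun j _ => ?_
  have hij : (⟨((i : ℕ) + j) % d.len c, Nat.mod_lt _ (d.len_pos c)⟩ : Fin (d.len c)) = i + j :=
    Fin.ext (Fin.val_add i j).symm
  rw [d.pow_entry, hij, ← mul_assoc, ← C_mul, ← pow_add, ← mul_add, Equiv.coe_addLeft]
  congr 2
  rw [Fin.val_add, mul_comm (i : ℕ), mul_comm (i : ℕ), pow_mul, pow_mul]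
  congr 1
  exact pow_eq_pow_mod _ hξ

theorem sum_pow_mul_pow {l : ℕ} {ζ : K} (hζ : IsPrimitiveRoot ζ l) (s j : Fin l) :
    ∑ i : Fin l, ζ ^ ((i : ℕ) * (l - s)) * ζ ^ ((i : ℕ) * j) = if j = s then (l : K) else 0 := by
  have h1 : ∑ i : Fin l, ζ ^ ((i : ℕ) * (l - s)) * ζ ^ ((i : ℕ) * j) =
      ∑ i ∈ Finset.range l, (ζ ^ (l - s + j : ℕ)) ^ i := by
    rw [Finset.sum_range]
    refine Finset.sum_congr rfl fun i _ => ?_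
    rw [← pow_add, ← mul_add, mul_comm, pow_mul]
  rw [h1]
  split_ifs with hjs
  · have : l - s + j = l := by
      rw [hjs]
      omega
    rw [this, hζ.pow_eq_one]
    simp
  · have hne : ζ ^ (l - s + j : ℕ) ≠ 1 := by
      rw [Ne, hζ.pow_eq_one_iff_dvd]
      rintro ⟨q, hq⟩
      apply hjs
      apply Fin.ext
      -- The number `l - s + j` lies strictly between `0` and `2 * l`, so the only multiple of `l`
      -- it can be is `l` itself.
      obtain rfl | rfl | hq2 : q = 0 ∨ q = 1 ∨ 2 ≤ q := by omega
      · omega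
      · omega
      · have := Nat.mul_le_mul_left l hq2
        omega
    have h2 := geom_sum_mul (ζ ^ (l - s + j : ℕ)) l
    rw [← pow_mul ζ, mul_comm (l - s + j : ℕ), pow_mul ζ l, hζ.pow_eq_one, one_pow, sub_self] at h2
    exact (mul_eq_zero.mp h2).resolve_right (sub_ne_zero.mpr hne)

theorem tau_surjective (d : CycleDecomposition σ) {ξ : K} (hξ : IsPrimitiveRoot ξ (orderOf σ)) :
    Function.Surjective (tau d ξ) := by
  rw [← AlgHom.range_eq_top, eq_top_iff, ← adjoin_range_X, Algebra.adjoin_le_iff]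
  rintro _ ⟨v, rfl⟩
  obtain ⟨⟨c, s⟩, rfl⟩ := d.entry.surjective v
  set ζ := ξ ^ (orderOf σ / d.len c) with hζ
  have hζp : IsPrimitiveRoot ζ (d.len c) :=
    hξ.pow (orderOf_pos σ) (Nat.div_mul_cancel (d.len_dvd_orderOf c)).symm
  have : NeZero (d.len c) := ⟨(d.len_pos c).ne'⟩
  have hl0 : (d.len c : K) ≠ 0 := (hζp.neZero').out
  have hmem : ∀ w, eigenform d ξ w ∈ (tau d ξ).range := fun w => ⟨X w, by simp [tau]⟩
  -- Inverse Fourier transform on the cycle, with `d.len c - s` standing for the exponent `-s`. The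
  -- length is invertible because a primitive root of that order exists in `K`.
  have hX : X (d.entry ⟨c, s⟩) = C ((d.len c : K)⁻¹) *
      ∑ i : Fin (d.len c), C (ζ ^ ((i : ℕ) * (d.len c - s))) *
      (C (ζ ^ ((i : ℕ) * (i : ℕ))) * eigenform d ξ (d.entry ⟨c, i⟩)) := by
    simp_rw [hζ, C_mul_eigenform_entry d hζp.pow_eq_one, Finset.mul_sum]
    rw [Finset.sum_comm, Finset.sum_eq_single s]
    · simp_rw [← mul_assoc]
      rw [← Finset.sum_mul]
      simp_rw [← C_mul, mul_assoc]
      rw [← map_sum, ← Finset.mul_sum, ← hζ, sum_pow_mul_pow hζp, if_pos rfl, inv_mul_cancel₀ hl0, C_1, one_mul]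
    · intro j _ hj
      simp_rw [← mul_assoc]
      rw [← Finset.sum_mul]
      simp_rw [← C_mul, mul_assoc]
      rw [← map_sum, ← Finset.mul_sum, ← hζ, sum_pow_mul_pow hζp, if_neg hj, mul_zero, C_0, zero_mul]
    · exact fun h => absurd (Finset.mem_univ s) h
  rw [hX]
  have hC : ∀ a : K, (C a : MvPolynomial (Fin n) K) ∈ (tau d ξ).range := fun a =>
    (tau d ξ).range.algebraMap_mem a
  exact mul_mem (hC _) (sum_mem fun i _ => mul_mem (hC _) (mul_mem (hC _) (hmem _)))

/-- A surjective endomorphism of a Noetherian ring is injective. -/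
theorem injective_of_surjective_of_isNoetherianRing {R : Type*} [CommRing R] [IsNoetherianRing R]
    (f : R →+* R) (hf : Function.Surjective f) : Function.Injective f := by
  rw [injective_iff_map_eq_zero]
  intro x hx
  have hmono : Monotone fun k : ℕ => RingHom.ker (f ^ k) := by
    refine monotone_nat_of_le_succ fun k y hy => ?_
    rw [RingHom.mem_ker] at hy ⊢
    rw [pow_succ', RingHom.mul_def, RingHom.comp_apply, hy, map_zero]
  obtain ⟨k, hk⟩ := monotone_stabilizes_iff_noetherian.mpr inferInstance ⟨_, hmono⟩
  have hsurj : Function.Surjective (f ^ k) := by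
    rw [RingHom.coe_pow]
    exact hf.iterate k
  obtain ⟨y, rfl⟩ := hsurj x
  have hy : y ∈ RingHom.ker (f ^ (k + 1)) := by
    rwa [RingHom.mem_ker, pow_succ', RingHom.mul_def, RingHom.comp_apply]
  have hker : RingHom.ker (f ^ k) = RingHom.ker (f ^ (k + 1)) := hk (k + 1) (Nat.le_succ k)
  rw [← hker] at hy
  exact hy

/-- The procedure `symmStd` computes the reduced Gröbner basis. -/
theorem symmStd_eq_std (m : MonomialOrder (Fin n)) (d : CycleDecomposition σ) {ξ : K}
    (hξ : IsPrimitiveRoot ξ (orderOf σ)) (I : Ideal (MvPolynomial (Fin n) K)) :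
    symmStd m d ξ I = std m I := by
  have hsurj := tau_surjective d hξ
  have hinj : Function.Injective (tau d ξ) :=
    injective_of_surjective_of_isNoetherianRing (tau d ξ : MvPolynomial (Fin n) K →+* _) hsurj
  have : NeZero (orderOf σ) := ⟨(orderOf_pos σ).ne'⟩
  rw [symmStd, if_neg (hξ.neZero').out]
  congr 1
  set S := std m (I.map (tau d ξ)) with hS
  -- After applying `τ` both ideals are spanned by `S`; bijectivity allows `τ` to be cancelled.
  have hspan : (Ideal.span (tau d ξ ⁻¹' S)).map (tau d ξ) = I.map (tau d ξ) := by
    rw [Ideal.map_span, Set.image_preimage_eq _ hsurj, hS, span_std]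
  have := congrArg (Ideal.comap (tau d ξ)) hspan
  rwa [Ideal.comap_map_of_bijective _ ⟨hinj, hsurj⟩,
    Ideal.comap_map_of_bijective _ ⟨hinj, hsurj⟩] at this

end Eigenforms

/-! ### Chinese remaindering and rational reconstruction -/

section Lifting

theorem natCast_prod_primes_dvd {P : Finset ℕ} (hP : ∀ p ∈ P, p.Prime) {z : ℤ}
    (h : ∀ p ∈ P, (p : ℤ) ∣ z) : ((∏ p ∈ P, p : ℕ) : ℤ) ∣ z := by
  rw [Int.natCast_dvd]
  exact Finset.prod_primes_dvd _ (fun p hp => (hP p hp).prime)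
    fun p hp => Int.natCast_dvd.mp (h p hp)

theorem IsChineseRemainder.unique {P : Finset ℕ} (hP : ∀ p ∈ P, p.Prime)
    {c c' : (p : ℕ) → ZMod p} (hc : ∀ p ∈ P, c p = c' p) {a a' : ℕ}
    (h : IsChineseRemainder P c a) (h' : IsChineseRemainder P c' a') : a = a' := by
  have hdvd := natCast_prod_primes_dvd hP (z := (a : ℤ) - a') fun p hp => by
    rw [← ZMod.intCast_zmod_eq_zero_iff_dvd]
    push_cast
    rw [h.2 p hp, h'.2 p hp, hc p hp, sub_self]
  have h1 := h.1
  have h2 := h'.1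
  have := Int.eq_zero_of_abs_lt_dvd hdvd (by rw [abs_lt]; omega)
  omega

theorem IsFareyLift.unique {N a : ℕ} (hN : 0 < N) {q q' : ℚ} (h : IsFareyLift N a q)
    (h' : IsFareyLift N a q') : q = q' := by
  obtain ⟨h1, h2, -, h4⟩ := h
  obtain ⟨h1', h2', -, h4'⟩ := h'
  have hdvd : (N : ℤ) ∣ q.num * q'.den - q'.num * q.den := by
    rw [← ZMod.intCast_zmod_eq_zero_iff_dvd]
    push_cast
    rw [h4, h4']
    ring
  have hB : Nat.sqrt ((N - 1) / 2) * Nat.sqrt ((N - 1) / 2) ≤ (N - 1) / 2 := Nat.sqrt_le _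
  have e1 : (q.num * q'.den).natAbs ≤ (N - 1) / 2 := by
    rw [Int.natAbs_mul, Int.natAbs_natCast]
    exact (Nat.mul_le_mul h1 h2').trans hB
  have e2 : (q'.num * q.den).natAbs ≤ (N - 1) / 2 := by
    rw [Int.natAbs_mul, Int.natAbs_natCast]
    exact (Nat.mul_le_mul h1' h2).trans hB
  -- Each cross product is at most `(N - 1) / 2` in absolute value, so their difference is smaller
  -- than `N` and cannot be a nonzero multiple of it.
  have h0 := Int.eq_zero_of_abs_lt_dvd hdvd (by rw [abs_lt]; omega)
  rw [Rat.eq_iff_mul_eq_mul]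
  omega

/-- Rational numbers obtained by the Chinese remainder algorithm and the Farey rational map. -/
def IsRationalLift (P : Finset ℕ) (c : (p : ℕ) → ZMod p) (q : ℚ) : Prop :=
  ∃ a : ℕ, IsChineseRemainder P c a ∧ IsFareyLift (∏ p ∈ P, p) a q

theorem IsRationalLift.unique {P : Finset ℕ} (hP : ∀ p ∈ P, p.Prime) {c c' : (p : ℕ) → ZMod p}
    (hc : ∀ p ∈ P, c p = c' p) {q q' : ℚ} (h : IsRationalLift P c q)
    (h' : IsRationalLift P c' q') : q = q' := by
  obtain ⟨a, ha, hq⟩ := h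
  obtain ⟨a', ha', hq'⟩ := h'
  obtain rfl := ha.unique hP hc ha'
  exact hq.unique (Finset.prod_pos fun p hp => (hP p hp).pos) hq'

theorem isRationalLift_reduceCoeff {P : Finset ℕ} (hP : ∀ p ∈ P, p.Prime) {q : ℚ}
    (hden : ∀ p ∈ P, ¬ p ∣ q.den) (h1 : q.num.natAbs ≤ Nat.sqrt (((∏ p ∈ P, p) - 1) / 2))
    (h2 : q.den ≤ Nat.sqrt (((∏ p ∈ P, p) - 1) / 2)) :
    IsRationalLift P (fun p => reduceCoeff p q) q := by
  set N := ∏ p ∈ P, p with hN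
  have : NeZero N := ⟨(Finset.prod_pos fun p hp => (hP p hp).pos).ne'⟩
  have hcop : Nat.Coprime q.den N := Nat.Coprime.prod_right fun p hp =>
    ((hP p hp).coprime_iff_not_dvd.mpr (hden p hp)).symm
  set x : ZMod N := q.num * (q.den : ZMod N)⁻¹ with hx
  have hxden : (q.num : ZMod N) = (x.val : ZMod N) * q.den := by
    rw [ZMod.natCast_zmod_val, hx, mul_assoc, mul_comm _ (q.den : ZMod N),
      ZMod.coe_mul_inv_eq_one _ hcop, mul_one]
  refine ⟨x.val, ⟨ZMod.val_lt x, fun p hp => ?_⟩, h1, h2, hcop, hxden⟩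
  have : Fact p.Prime := ⟨hP p hp⟩
  have hdvd : (N : ℤ) ∣ q.num - x.val * q.den := by
    rw [← ZMod.intCast_zmod_eq_zero_iff_dvd]
    push_cast
    rw [← hxden, sub_self]
  have hpdvd : (p : ℤ) ∣ q.num - x.val * q.den :=
    (Int.natCast_dvd_natCast.mpr (Finset.dvd_prod_of_mem _ hp)).trans hdvd
  rw [← ZMod.intCast_zmod_eq_zero_iff_dvd] at hpdvd
  push_cast at hpdvd
  change _ = (q.num : ZMod p) * (q.den : ZMod p)⁻¹
  rw [sub_eq_zero.mp hpdvd, mul_inv_cancel_right₀ (natCast_den_ne_zero (hden p hp))]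

variable {ι : Type*} (m : MonomialOrder ι)

theorem isPolynomialLift_iff {P : Finset ℕ} {h : (p : ℕ) → MvPolynomial ι (ZMod p)}
    {g : MvPolynomial ι ℚ} :
    IsPolynomialLift P h g ↔ ∀ b, IsRationalLift P (fun p => coeff b (h p)) (coeff b g) := Iff.rfl

/-- Any lifted coefficient has denominator at least `1`. This puts `0` and `1` in the Farey range,
so by uniqueness these residues lift to themselves. -/
theorem IsPolynomialLift.one_le_sqrt {P : Finset ℕ} {h : (p : ℕ) → MvPolynomial ι (ZMod p)}
    {g : MvPolynomial ι ℚ} (hl : IsPolynomialLift P h g) :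
    1 ≤ Nat.sqrt (((∏ p ∈ P, p) - 1) / 2) := by
  obtain ⟨a, -, -, h2, -⟩ := hl 0
  exact (Nat.one_le_iff_ne_zero.mpr (Rat.den_nz _)).trans h2

theorem IsPolynomialLift.coeff_eq_zero {P : Finset ℕ} (hP : ∀ p ∈ P, p.Prime)
    {h : (p : ℕ) → MvPolynomial ι (ZMod p)} {g : MvPolynomial ι ℚ}
    (hl : IsPolynomialLift P h g) {b : ι →₀ ℕ} (hb : ∀ p ∈ P, coeff b (h p) = 0) :
    coeff b g = 0 := by
  refine (isPolynomialLift_iff.mp hl b).unique hP (fun p hp => ?_)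
    (isRationalLift_reduceCoeff hP (q := 0) (fun p hp => ?_) (Nat.zero_le _) hl.one_le_sqrt)
  · rw [hb p hp, reduceCoeff_zero]
  · exact fun hd => (hP p hp).one_lt.ne' (Nat.dvd_one.mp hd)

theorem IsPolynomialLift.coeff_eq_one {P : Finset ℕ} (hP : ∀ p ∈ P, p.Prime)
    {h : (p : ℕ) → MvPolynomial ι (ZMod p)} {g : MvPolynomial ι ℚ}
    (hl : IsPolynomialLift P h g) {b : ι →₀ ℕ} (hb : ∀ p ∈ P, coeff b (h p) = 1) :
    coeff b g = 1 := by
  refine (isPolynomialLift_iff.mp hl b).unique hP (fun p hp => ?_)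
    (isRationalLift_reduceCoeff hP (q := 1) (fun p hp => ?_) hl.one_le_sqrt hl.one_le_sqrt)
  · rw [hb p hp, reduceCoeff_one]
  · exact fun hd => (hP p hp).one_lt.ne' (Nat.dvd_one.mp hd)

theorem IsPolynomialLift.exists_mem_support {P : Finset ℕ} (hP : ∀ p ∈ P, p.Prime)
    {h : (p : ℕ) → MvPolynomial ι (ZMod p)} {g : MvPolynomial ι ℚ}
    (hl : IsPolynomialLift P h g) {b : ι →₀ ℕ} (hb : b ∈ g.support) :
    ∃ p ∈ P, b ∈ (h p).support := by
  by_contra! hne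
  exact mem_support_iff.mp hb
    (hl.coeff_eq_zero hP fun p hp => notMem_support_iff.mp (hne p hp))

theorem IsPolynomialLift.nonempty {P : Finset ℕ} {h : (p : ℕ) → MvPolynomial ι (ZMod p)}
    {g : MvPolynomial ι ℚ} (hl : IsPolynomialLift P h g) : P.Nonempty := by
  by_contra hne
  have := hl.one_le_sqrt
  rw [Finset.not_nonempty_iff_eq_empty.mp hne] at this
  simp at this

theorem IsPolynomialLift.degree_eq {P : Finset ℕ} (hP : ∀ p ∈ P, p.Prime)
    {I : (p : ℕ) → Ideal (MvPolynomial ι (ZMod p))}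
    {h : (p : ℕ) → MvPolynomial ι (ZMod p)} {g : MvPolynomial ι ℚ}
    (hl : IsPolynomialLift P h g) {b : ι →₀ ℕ}
    (hb : ∀ p ∈ P, h p ∈ std m (I p) ∧ m.degree (h p) = b) :
    m.degree g = b ∧ coeff b g = 1 := by
  have h1 : coeff b g = 1 := hl.coeff_eq_one hP fun p hp => by
    rw [← (hb p hp).2]
    exact coeff_degree_of_mem_std m (hb p hp).1
  refine ⟨m.toSyn.injective (le_antisymm (m.degree_le_iff.mpr fun c hc => ?_) (m.le_degree ?_)), h1⟩
  · obtain ⟨p, hp, hcp⟩ := hl.exists_mem_support hP hc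
    rw [← (hb p hp).2]
    exact m.le_degree hcp
  · rw [mem_support_iff, h1]
    exact one_ne_zero

/-- A Gröbner basis which is the lift of reduced Gröbner bases is reduced. -/
theorem IsLift.isReducedGroebnerBasis {P : Finset ℕ} (hP : ∀ p ∈ P, p.Prime)
    {I : (p : ℕ) → Ideal (MvPolynomial ι (ZMod p))}
    {GP : (p : ℕ) → Set (MvPolynomial ι (ZMod p))} (hGP : ∀ p ∈ P, GP p = std m (I p))
    {G : Set (MvPolynomial ι ℚ)} (hl : IsLift m P GP G) {J : Ideal (MvPolynomial ι ℚ)}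
    (hG : IsGroebnerBasis m G J) : IsReducedGroebnerBasis m G J := by
  obtain ⟨L, hL, hlift, -⟩ := hl
  have key : ∀ g ∈ G, ∃ h : (p : ℕ) → MvPolynomial ι (ZMod p),
      (∀ p ∈ P, h p ∈ std m (I p) ∧ m.degree (h p) = m.degree g) ∧ IsPolynomialLift P h g ∧
      m.degree g ∈ L ∧ coeff (m.degree g) g = 1 := by
    intro g hg
    obtain ⟨b, hbL, h, hh, hpl⟩ := hlift g hg
    have hh' : ∀ p ∈ P, h p ∈ std m (I p) ∧ m.degree (h p) = b := fun p hp => by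
      rw [← hGP p hp]
      exact hh p hp
    obtain ⟨rfl, h1⟩ := hpl.degree_eq m hP hh'
    exact ⟨h, hh', hpl, hbL, h1⟩
  have hmem : ∀ p ∈ P, ∀ b ∈ L, ∃ f ∈ std m (I p), m.degree f = b := by
    intro p hp b hb
    rw [← hL p hp, hGP p hp] at hb
    obtain ⟨f, hf, -, hd⟩ := hb
    exact ⟨f, hf, hd⟩
  refine { hG with zero_notMem := ?_, not_dvd := ?_, leadingCoeff_eq := ?_, tail := ?_ }
  · intro h0
    obtain ⟨h, -, -, -, h1⟩ := key 0 h0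
    rw [coeff_zero] at h1
    exact zero_ne_one h1
  · intro f hf g hg hne hle
    obtain ⟨h, hh, hpl, hfL, -⟩ := key f hf
    obtain ⟨h', hh', hpl', hgL, -⟩ := key g hg
    -- If one leading monomial divides the other, minimality modulo each `p` makes the modular
    -- elements equal, and uniqueness of lifting makes `f = g`.
    refine hne (MvPolynomial.ext _ _ fun b => (isPolynomialLift_iff.mp hpl b).unique hP
      (fun p hp => ?_) (isPolynomialLift_iff.mp hpl' b))
    rw [eq_of_mem_std m (hh p hp).1 (hh' p hp).1]
    have hmin := ((mem_std_iff m).mp (hh p hp).1).2.2.2.1 (m.degree g)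
      ⟨h' p, (hh' p hp).1.1, (hh' p hp).1.2.1, (hh' p hp).2⟩
    rw [(hh p hp).2] at hmin
    rw [(hh p hp).2, (hh' p hp).2, hmin hle]
  · intro g hg
    obtain ⟨-, -, -, -, h1⟩ := key g hg
    exact h1
  · intro g hg b hb hbg f hf
    obtain ⟨h, hh, hpl, -, -⟩ := key g hg
    obtain ⟨-, -, -, hfL, -⟩ := key f hf
    -- A tail monomial of `g` already occurs modulo some `p`, where reducedness is known.
    obtain ⟨p, hp, hbp⟩ := hpl.exists_mem_support hP hb
    obtain ⟨f', hf', hd⟩ := hmem p hp _ hfL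
    rw [← hd]
    exact (hh p hp).1.2.2.2.2 b hbp (by rwa [(hh p hp).2]) f' hf'.1 hf'.2.1

/-- The reduced Gröbner basis is the lift of its reductions if sufficiently many primes are used. -/
theorem isLift_std {P : Finset ℕ} (hP : ∀ p ∈ P, p.Prime) {I : Ideal (MvPolynomial ι ℚ)}
    {GP : (p : ℕ) → Set (MvPolynomial ι (ZMod p))}
    (hGP : ∀ p ∈ P, IntegralAt p (std m I) ∧ reduceMod p '' std m I = GP p)
    (hbound : ∀ g ∈ std m I, ∀ b,
      (coeff b g).num.natAbs ≤ Nat.sqrt (((∏ p ∈ P, p) - 1) / 2) ∧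
        (coeff b g).den ≤ Nat.sqrt (((∏ p ∈ P, p) - 1) / 2)) :
    IsLift m P GP (std m I) := by
  have hdeg : ∀ p ∈ P, ∀ g ∈ std m I, m.degree (reduceMod p g) = m.degree g := by
    intro p hp g hg
    have : Fact p.Prime := ⟨hP p hp⟩
    refine degree_reduceMod m ?_
    rw [coeff_degree_of_mem_std m hg, reduceCoeff_one]
    exact one_ne_zero
  have hpl : ∀ g ∈ std m I, IsPolynomialLift P (fun p => reduceMod p g) g := by
    intro g hg
    rw [isPolynomialLift_iff]
    intro b
    simp only [coeff_reduceMod]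
    exact isRationalLift_reduceCoeff hP (fun p hp => (hGP p hp).1 g hg b) (hbound g hg b).1
      (hbound g hg b).2
  have hmem : ∀ g ∈ std m I, ∀ p ∈ P,
      reduceMod p g ∈ GP p ∧ m.degree (reduceMod p g) = m.degree g := fun g hg p hp =>
    ⟨(hGP p hp).2 ▸ ⟨g, hg, rfl⟩, hdeg p hp g hg⟩
  refine ⟨leadingExponents m (std m I), fun p hp => ?_,
    fun g hg => ⟨_, ⟨g, hg, hg.2.1, rfl⟩, _, hmem g hg, hpl g hg⟩, ?_⟩
  · rw [← (hGP p hp).2]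
    ext a
    constructor
    · rintro ⟨_, ⟨g, hg, rfl⟩, -, rfl⟩
      exact ⟨g, hg, hg.2.1, (hdeg p hp g hg).symm⟩
    · rintro ⟨g, hg, -, rfl⟩
      refine ⟨_, ⟨g, hg, rfl⟩, fun h0 => ?_, hdeg p hp g hg⟩
      have : Fact p.Prime := ⟨hP p hp⟩
      have h1 := coeff_reduceMod p g (m.degree g)
      rw [h0, coeff_zero, coeff_degree_of_mem_std m hg, reduceCoeff_one] at h1
      exact zero_ne_one h1
  · rintro _ ⟨g, hg, -, rfl⟩
    exact ⟨g, hg, _, hmem g hg, hpl g hg⟩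

theorem exists_coeff_bound {S : Set (MvPolynomial ι ℚ)} (hS : S.Finite) :
    ∃ M : ℕ, ∀ g ∈ S, ∀ b, (coeff b g).num.natAbs ≤ M ∧ (coeff b g).den ≤ M := by
  classical
  set T := hS.toFinset.biUnion fun g => g.support.image fun b => coeff b g
  -- The summand `1` covers zero coefficients, whose denominator is `1`.
  refine ⟨1 + ∑ q ∈ T, (q.num.natAbs + q.den), fun g hg b => ?_⟩
  by_cases hb : b ∈ g.support
  · have hmem : coeff b g ∈ T := Finset.mem_biUnion.mpr
      ⟨g, hS.mem_toFinset.mpr hg, Finset.mem_image_of_mem _ hb⟩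
    have := Finset.single_le_sum (f := fun q : ℚ => q.num.natAbs + q.den)
      (fun _ _ => Nat.zero_le _) hmem
    omega
  · rw [notMem_support_iff.mp hb]
    simp

/-- A candidate has small coefficients, hence every large prime can be used to test it. -/
theorem IsLift.unitAt {P : Finset ℕ} {GP : (p : ℕ) → Set (MvPolynomial ι (ZMod p))}
    {G : Set (MvPolynomial ι ℚ)} (hl : IsLift m P GP G) {p : ℕ}
    (hp : ∏ q ∈ P, q ≤ p) : UnitAt p G := by
  obtain ⟨_, _, hlift, _⟩ := hl
  intro g hg b hb
  obtain ⟨_, _, _, _, hpl⟩ := hlift g hg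
  obtain ⟨_, _, h1, h2, _⟩ := hpl b
  have h3 := (Nat.sqrt_le_self (((∏ q ∈ P, q) - 1) / 2))
  have hd := (coeff b g).den_pos
  have hn : 0 < (coeff b g).num.natAbs :=
    Int.natAbs_pos.mpr (Rat.num_ne_zero.mpr (mem_support_iff.mp hb))
  constructor <;> intro hdvd <;> have := Nat.le_of_dvd (by assumption) hdvd <;> omega

end Lifting

/-! ### Existence of admissible choices -/

section Choices

theorem exists_primitiveRoot_zmod {p k : ℕ} (hp : p.Prime) (hk : k ∣ p - 1) :
    ∃ ξ : ZMod p, IsPrimitiveRoot ξ k := by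
  have : Fact p.Prime := ⟨hp⟩
  obtain ⟨g, hg⟩ := IsCyclic.exists_ofOrder_eq_natCard (α := (ZMod p)ˣ)
  rw [Nat.card_eq_fintype_card, ZMod.card_units] at hg
  have hprim : IsPrimitiveRoot g (p - 1) := hg ▸ IsPrimitiveRoot.orderOf g
  obtain ⟨q, hq⟩ := hk
  refine ⟨((g ^ q : (ZMod p)ˣ) : ZMod p), IsPrimitiveRoot.coe_units_iff.mpr ?_⟩
  exact hprim.pow (by have := hp.two_le; omega) (by rw [hq, mul_comm])

/-- The ascending chain of colon ideals `(J : t^k)` stabilizes in a Noetherian ring. -/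
theorem exists_isSaturationExponent {ι K : Type*} [Finite ι] [Field K]
    (J : Ideal (MvPolynomial (Option ι) K)) : ∃ e, IsSaturationExponent J e := by
  have hmono : Monotone fun k : ℕ => Submodule.comap
      (LinearMap.mulLeft (MvPolynomial (Option ι) K) ((X none : MvPolynomial (Option ι) K) ^ k))
      J := by
    refine monotone_nat_of_le_succ fun k f hf => ?_
    rw [Submodule.mem_comap, LinearMap.mulLeft_apply] at hf ⊢
    rw [pow_succ', mul_assoc]
    exact J.mul_mem_left _ hf
  obtain ⟨e, he⟩ := monotone_stabilizes_iff_noetherian.mpr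
    (inferInstance : IsNoetherian (MvPolynomial (Option ι) K) (MvPolynomial (Option ι) K))
    ⟨_, hmono⟩
  refine ⟨e, fun j f hf => ?_⟩
  have hmem : f ∈ Submodule.comap (LinearMap.mulLeft (MvPolynomial (Option ι) K)
      ((X none : MvPolynomial (Option ι) K) ^ (max e j))) J := hmono (le_max_right e j) hf
  have heq := he (max e j) (le_max_left e j)
  exact (SetLike.ext_iff.mp heq f).mpr hmem

theorem exists_isMajorityClass {ι : Type*} (m : MonomialOrder ι)
    (GP : (p : ℕ) → Set (MvPolynomial ι (ZMod p))) (P : Finset ℕ) :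
    ∃ Q, IsMajorityClass m GP P Q := by
  classical
  rcases P.eq_empty_or_nonempty with rfl | hne
  · refine ⟨∅, ⟨∅, by simp⟩, fun Q' hQ' _ => ?_⟩
    rw [Finset.subset_empty.mp hQ']
  · obtain ⟨q, hq, hmax⟩ := Finset.exists_max_image P
      (fun q => (P.filter fun p => leadingExponents m (GP p) = leadingExponents m (GP q)).card) hne
    refine ⟨_, ⟨leadingExponents m (GP q), fun p => Finset.mem_filter⟩, ?_⟩
    rintro Q' hQ' ⟨L, hL⟩
    rcases Q'.eq_empty_or_nonempty with rfl | ⟨r, hr⟩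
    · simp
    · refine (Finset.card_le_card fun p hp => ?_).trans (hmax r (hQ' hr))
      exact Finset.mem_filter.mpr ⟨hQ' hp, (hL p hp).trans (hL r hr).symm⟩

theorem nonempty_cycleDecomposition {n : ℕ} (σ : Equiv.Perm (Fin n)) :
    Nonempty (CycleDecomposition σ) := by
  classical
  let s := Equiv.Perm.SameCycle.setoid σ
  let e := Fintype.equivFin (Quotient s)
  let rep : Fin (Fintype.card (Quotient s)) → Fin n := fun c => (e.symm c).out
  -- Cycles are the orbits of `σ`, each traversed from a chosen representative for one minimal
  -- period.
  let len : Fin (Fintype.card (Quotient s)) → ℕ := fun c => Function.minimalPeriod σ (rep c)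
  have hlen : ∀ c, 0 < len c := fun c => Function.minimalPeriod_pos_of_mem_periodicPts
    ⟨orderOf σ, orderOf_pos σ, by
      rw [Function.IsPeriodicPt, Function.IsFixedPt, Equiv.Perm.iterate_eq_pow,
        pow_orderOf_eq_one, Equiv.Perm.one_apply]⟩
  have hcls : ∀ c i, (⟦σ^[i] (rep c)⟧ : Quotient s) = e.symm c := fun c i => by
    rw [← (e.symm c).out_eq]
    refine Quotient.sound ?_
    rw [Equiv.Perm.iterate_eq_pow]
    exact Equiv.Perm.sameCycle_pow_left.mpr (Equiv.Perm.SameCycle.refl _ _)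
  let f : (Σ c, Fin (len c)) → Fin n := fun x => σ^[(x.2 : ℕ)] (rep x.1)
  have hinj : Function.Injective f := by
    rintro ⟨c, i⟩ ⟨c', i'⟩ h
    have hc : c = c' := e.symm.injective (by
      rw [← hcls c i, ← hcls c' i']
      exact congrArg _ h)
    subst hc
    have : (i : ℕ) = i' := Function.iterate_injOn_Iio_minimalPeriod i.2 i'.2 h
    rw [Fin.ext this]
  have hsurj : Function.Surjective f := by
    intro v
    have hv : σ.SameCycle (rep (e ⟦v⟧)) v := by
      have h : (⟦rep (e ⟦v⟧)⟧ : Quotient s) = ⟦v⟧ := by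
        change (⟦(e.symm (e ⟦v⟧)).out⟧ : Quotient s) = _
        rw [Quotient.out_eq, Equiv.symm_apply_apply]
      exact Quotient.exact h
    obtain ⟨i, hi⟩ := hv.exists_nat_pow_eq
    refine ⟨⟨e ⟦v⟧, ⟨i % len (e ⟦v⟧), Nat.mod_lt _ (hlen _)⟩⟩, ?_⟩
    change σ^[i % len (e ⟦v⟧)] (rep (e ⟦v⟧)) = v
    rw [Function.iterate_mod_minimalPeriod_eq, Equiv.Perm.iterate_eq_pow, hi]
  refine ⟨⟨_, len, hlen, Equiv.ofBijective f ⟨hinj, hsurj⟩, fun c i => ?_⟩⟩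
  have : NeZero (len c) := ⟨(hlen c).ne'⟩
  change σ (σ^[(i : ℕ)] (rep c)) = σ^[((finRotate (len c) i : Fin (len c)) : ℕ)] (rep c)
  rw [finRotate_apply, Fin.val_add, Fin.val_one', Nat.add_mod_mod,
    Function.iterate_mod_minimalPeriod_eq, Function.iterate_succ_apply']

theorem exists_prime_unitAt {ι : Type*} {F : Set (MvPolynomial ι ℚ)} (hF : F.Finite) (N : ℕ) :
    ∃ p, p.Prime ∧ N < p ∧ UnitAt p F := by
  obtain ⟨M, hM⟩ := exists_coeff_bound hF
  obtain ⟨p, hp, hprime⟩ := Nat.exists_infinite_primes (N + M + 1)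
  refine ⟨p, hprime, by omega, fun f hf b hb => ?_⟩
  obtain ⟨h1, h2⟩ := hM f hf b
  have hd := (coeff b f).den_pos
  have hn : 0 < (coeff b f).num.natAbs :=
    Int.natAbs_pos.mpr (Rat.num_ne_zero.mpr (mem_support_iff.mp hb))
  constructor <;> intro hdvd <;> have := Nat.le_of_dvd (by assumption) hdvd <;> omega

variable {n : ℕ} (m : MonomialOrder (Fin n)) (σ : Equiv.Perm (Fin n))
  {F : Set (MvPolynomial (Fin n) ℚ)}

theorem infinite_admissible_primes (hF : F.Finite) :
    {p : ℕ | p.Prime ∧ orderOf σ ∣ p - 1 ∧ IntegralAt p F ∧ ¬ IsMisleading m F p}.Infinite := by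
  have hinf : {p : ℕ | p.Prime ∧ orderOf σ ∣ p - 1}.Infinite := by
    rw [Set.infinite_iff_exists_gt]
    intro N
    obtain ⟨p, hp, hN, hmod⟩ := Nat.exists_prime_gt_modEq_one N (orderOf_pos σ).ne'
    exact ⟨p, ⟨hp, (Nat.modEq_iff_dvd' hp.one_le).mp hmod.symm⟩, hN⟩
  have hfin : {p : ℕ | ¬ (p.Prime → IntegralAt p F)}.Finite := eventually_integralAt hF
  refine (hinf.sdiff (hfin.union (finite_isMisleading m hF))).mono ?_
  rintro p ⟨⟨hp, hk⟩, hbad⟩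
  rw [Set.mem_union, not_or] at hbad
  exact ⟨hp, hk, not_not.mp hbad.1 hp, hbad.2⟩

theorem exists_generic_execution (hF : F.Finite) : ∃ r : Execution m σ F, r.IsGeneric := by
  classical
  obtain ⟨d⟩ := nonempty_cycleDecomposition σ
  have hinf := infinite_admissible_primes m σ hF
  have hS : ∀ i, Nat.nth (fun p => p.Prime ∧ orderOf σ ∣ p - 1 ∧ IntegralAt p F ∧
      ¬ IsMisleading m F p) i ∈
        {p : ℕ | p.Prime ∧ orderOf σ ∣ p - 1 ∧ IntegralAt p F ∧ ¬ IsMisleading m F p} :=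
    fun i => Nat.nth_mem_of_infinite hinf i
  have hmono := (Nat.nth_strictMono hinf).injective
  set en : ℕ → ℕ := Nat.nth (fun p => p.Prime ∧ orderOf σ ∣ p - 1 ∧ IntegralAt p F ∧
      ¬ IsMisleading m F p)
  -- The pairing function splits the admissible primes into disjoint rows; batch `i` takes `i + 1`
  -- primes of row `i`.
  let batch : ℕ → Finset ℕ := fun i => (Finset.range (i + 1)).image fun j => en (Nat.pair i j)
  have hbatch : ∀ i, ∀ p ∈ batch i, p.Prime ∧ orderOf σ ∣ p - 1 ∧ IntegralAt p F ∧
      ¬ IsMisleading m F p := by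
    intro i p hp
    obtain ⟨j, -, rfl⟩ := Finset.mem_image.mp hp
    exact hS _
  let root : (p : ℕ) → ZMod p := fun p =>
    if h : p.Prime ∧ orderOf σ ∣ p - 1 then (exists_primitiveRoot_zmod h.1 h.2).choose else 0
  have hroot : ∀ i, ∀ p ∈ batch i, IsPrimitiveRoot (root p) (orderOf σ) := by
    intro i p hp
    have h : p.Prime ∧ orderOf σ ∣ p - 1 := ⟨(hbatch i p hp).1, (hbatch i p hp).2.1⟩
    simp only [root, dif_pos h]
    exact (exists_primitiveRoot_zmod h.1 h.2).choose_spec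
  choose maj hmaj using exists_isMajorityClass m fun p => symmStd m d (root p) (modIdeal p F)
  let kept : ℕ → Finset ℕ := fun i =>
    Nat.rec (maj (batch 0)) (fun i K => maj (K ∪ batch (i + 1))) i
  have hkept : ∀ i, ∀ p ∈ kept i, p.Prime := by
    intro i
    induction i with
    | zero =>
      intro p hp
      obtain ⟨L, hL⟩ := (hmaj (batch 0)).1
      exact (hbatch 0 p ((hL p).mp hp).1).1
    | succ i ih =>
      intro p hp
      obtain ⟨L, hL⟩ := (hmaj (kept i ∪ batch (i + 1))).1
      rcases Finset.mem_union.mp ((hL p).mp hp).1 with h | h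
      · exact ih p h
      · exact (hbatch _ p h).1
  -- Exceeding the product keeps the test prime out of `kept i` and larger than every numerator and
  -- denominator of a candidate; exceeding `i` makes the test primes unbounded.
  choose tp htp hgt hunit using fun i => exists_prime_unitAt hF (i + ∏ p ∈ kept i, p)
  have hexp : ∀ i, ∃ e, IsSaturationExponent (modIdeal (tp i) (homogenize '' F)) e := fun i => by
    have : Fact (tp i).Prime := ⟨htp i⟩
    exact exists_isSaturationExponent _
  choose ex hex using hexp
  refine ⟨{
    cycles := d
    root := root
    batch := batch
    kept := kept
    testPrime := tp
    exponent := ex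
    batch_prime := fun i p hp => (hbatch i p hp).1
    batch_dvd := fun i p hp => (hbatch i p hp).2.1
    batch_integral := fun i p hp => (hbatch i p hp).2.2.1
    root_spec := hroot
    kept_zero := hmaj _
    kept_succ := fun i => hmaj _
    testPrime_prime := htp
    testPrime_notMem := fun i hi => ?_
    testPrime_input := hunit
    testPrime_lift := fun i G hG => hG.unitAt m (by have := hgt i; omega)
    exponent_spec := hex }, ?_, ?_, ?_, ?_⟩
  · have h1 := Nat.le_of_dvd (Finset.prod_pos fun p hp => (hkept i p hp).pos)
      (Finset.dvd_prod_of_mem (fun p => p) hi)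
    have := hgt i
    omega
  · intro i j hij
    rw [Finset.disjoint_left]
    intro p hp hp'
    obtain ⟨a, -, rfl⟩ := Finset.mem_image.mp hp
    obtain ⟨b, -, hb⟩ := Finset.mem_image.mp hp'
    exact hij (Nat.pair_eq_pair.mp (hmono hb)).1.symm
  · intro B
    refine ⟨B, ?_⟩
    change B ≤ ((Finset.range (B + 1)).image fun j => en (Nat.pair B j)).card
    rw [Finset.card_image_of_injective _ fun a b h => (Nat.pair_eq_pair.mp (hmono h)).2,
      Finset.card_range]
    exact Nat.le_succ B
  · rw [Set.infinite_iff_exists_gt]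
    exact fun N => ⟨tp N, ⟨N, rfl⟩, by have := hgt N; omega⟩
  · exact fun i p hp => (hbatch i p hp).2.2.2

end Choices

/-! ### Correctness and termination of the main loop -/

section Algorithm

/-- A class which contains more primes than there are primes outside of it is the largest one. -/
theorem IsMajorityClass.mem_iff {ι : Type*} {m : MonomialOrder ι}
    {GP : (p : ℕ) → Set (MvPolynomial ι (ZMod p))} {P Q U V : Finset ℕ} {L : Set (ι →₀ ℕ)}
    (h : IsMajorityClass m GP P Q) (hU : ∀ p ∈ P, leadingExponents m (GP p) ≠ L → p ∈ U)
    (hVP : V ⊆ P) (hVL : ∀ p ∈ V, leadingExponents m (GP p) = L) (hcard : U.card < V.card)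
    (p : ℕ) : p ∈ Q ↔ p ∈ P ∧ leadingExponents m (GP p) = L := by
  obtain ⟨⟨L', hL'⟩, hmax⟩ := h
  suffices hLL : L' = L by rw [hL', hLL]
  by_contra hne
  -- A class with another label lies inside `U`, so it is smaller than the competitor `V`.
  have hQU : Q ⊆ U := fun q hq => hU q ((hL' q).mp hq).1 (by rwa [((hL' q).mp hq).2])
  have h1 := Finset.card_le_card hQU
  have h2 := hmax V hVP ⟨L, hVL⟩
  omega

variable {n : ℕ} {m : MonomialOrder (Fin n)} {σ : Equiv.Perm (Fin n)}
  {F : Set (MvPolynomial (Fin n) ℚ)} (r : Execution m σ F)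

/-- The primes used in round `i` are a largest class of a list containing the new primes of this
round and the primes kept from the previous round. -/
theorem Execution.exists_pool (i : ℕ) : ∃ P : Finset ℕ,
    IsMajorityClass m (fun p => symmStd m r.cycles (r.root p) (modIdeal p F)) P (r.kept i) ∧
      r.batch i ⊆ P ∧ (∀ j, i = j + 1 → r.kept j ⊆ P) ∧ ∀ p ∈ P, ∃ j, p ∈ r.batch j := by
  induction i with
  | zero => exact ⟨_, r.kept_zero, Finset.Subset.refl _, fun j hj => by omega, fun p hp => ⟨0, hp⟩⟩
  | succ i ih =>
    obtain ⟨P, ⟨⟨L, hL⟩, -⟩, -, -, hP⟩ := ih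
    refine ⟨_, r.kept_succ i, Finset.subset_union_right, fun j hj => ?_, fun p hp => ?_⟩
    · obtain rfl : i = j := by omega
      exact Finset.subset_union_left
    · rcases Finset.mem_union.mp hp with h | h
      · exact hP p ((hL p).mp h).1
      · exact ⟨_, h⟩

theorem Execution.exists_mem_batch {i p : ℕ} (hp : p ∈ r.kept i) : ∃ j, p ∈ r.batch j := by
  obtain ⟨P, ⟨⟨L, hL⟩, -⟩, -, -, hP⟩ := r.exists_pool i
  exact hP p ((hL p).mp hp).1

theorem Execution.symmStd_eq {i p : ℕ} (hp : p ∈ r.batch i) :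
    symmStd m r.cycles (r.root p) (modIdeal p F) = std m (modIdeal p F) := by
  have : Fact p.Prime := ⟨r.batch_prime i p hp⟩
  exact symmStd_eq_std m r.cycles (r.root_spec i p hp) _

theorem Execution.isReducedGroebnerBasis_of_returns
    (hm : ∀ a b : Fin n →₀ ℕ, a.degree < b.degree → a ≺[m] b) {G : Set (MvPolynomial (Fin n) ℚ)}
    (h : r.Returns G) : IsReducedGroebnerBasis m G (Ideal.span F) := by
  obtain ⟨i, ⟨hlift, hver⟩, -⟩ := h
  refine hlift.isReducedGroebnerBasis m (I := fun p => modIdeal p F) (fun p hp => ?_)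
    (fun p hp => ?_) (hver.isGroebnerBasis m hm (r.testPrime_prime i) (r.testPrime_input i)
      (r.testPrime_lift i G hlift) (r.exponent_spec i))
  · obtain ⟨j, hj⟩ := r.exists_mem_batch hp
    exact r.batch_prime j p hj
  · obtain ⟨j, hj⟩ := r.exists_mem_batch hp
    exact r.symmStd_eq hj

theorem finalVerification_std {ι : Type*} [Finite ι] {m : MonomialOrder ι}
    {F : Set (MvPolynomial ι ℚ)} {p e : ℕ} [Fact p.Prime]
    (himg : reduceMod p '' std m (Ideal.span F) = std m (modIdeal p F))
    (hlucky : IsLucky (homOrder m)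
      (homogenize '' F ∪ {(X none : MvPolynomial (Option ι) ℚ) ^ e}) p) :
    FinalVerification m F p e (std m (Ideal.span F)) where
  modular := himg ▸ isGroebnerBasis_std m _
  input_le := (span_std m _).ge
  self := by
    rw [span_std]
    exact isGroebnerBasis_std m _
  lucky := hlucky

/-- From some round on, all primes in use are lucky, and there are arbitrarily many of them. -/
theorem Execution.eventually_lucky (hF : F.Finite) (hr : r.IsGeneric) (B : ℕ) :
    ∃ i₀, ∀ i ≥ i₀, B ≤ (r.kept i).card ∧ ∀ p ∈ r.kept i, IsLucky m F p := by
  classical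
  have hUfin : {p : ℕ | ¬ (p.Prime → IsLucky m F p)}.Finite := eventually_isLucky m hF
  set U := hUfin.toFinset with hU
  -- Removing the unlucky primes leaves at least `U.card + B + 1` lucky ones: more than all unlucky
  -- primes together, and at least `B`.
  obtain ⟨i₀, hi₀⟩ := hr.unbounded (2 * U.card + B + 1)
  set V := r.batch i₀ \ U with hV
  have hVcard : U.card + B + 1 ≤ V.card := by
    have := Finset.le_card_sdiff U (r.batch i₀)
    rw [← hV] at this
    omega
  set L := leadingExponents m (std m (Ideal.span F)) with hL
  have hlucky : ∀ {j p}, p ∈ r.batch j →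
      (leadingExponents m (symmStd m r.cycles (r.root p) (modIdeal p F)) = L ↔
        IsLucky m F p) := by
    intro j p hp
    rw [r.symmStd_eq hp]
    exact eq_comm
  have hVL : ∀ p ∈ V,
      leadingExponents m (symmStd m r.cycles (r.root p) (modIdeal p F)) = L := by
    intro p hp
    obtain ⟨hpb, hpU⟩ := Finset.mem_sdiff.mp hp
    rw [hU, Set.Finite.mem_toFinset] at hpU
    exact (hlucky hpb).mpr (not_not.mp hpU (r.batch_prime _ p hpb))
  have step : ∀ i P, IsMajorityClass m
      (fun p => symmStd m r.cycles (r.root p) (modIdeal p F)) P (r.kept i) →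
      (∀ p ∈ P, ∃ j, p ∈ r.batch j) → V ⊆ P →
        V ⊆ r.kept i ∧ ∀ p ∈ r.kept i, IsLucky m F p := by
    intro i P hmaj hP hVP
    have hmem := hmaj.mem_iff (U := U) (fun p hp hne => by
      obtain ⟨j, hj⟩ := hP p hp
      rw [hU, Set.Finite.mem_toFinset]
      exact fun h => hne ((hlucky hj).mpr (h (r.batch_prime j p hj)))) hVP hVL (by omega)
    refine ⟨fun p hp => (hmem p).mpr ⟨hVP hp, hVL p hp⟩, fun p hp => ?_⟩
    obtain ⟨hpP, hpL⟩ := (hmem p).mp hp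
    obtain ⟨j, hj⟩ := hP p hpP
    exact (hlucky hj).mp hpL
  have key : ∀ i ≥ i₀, V ⊆ r.kept i ∧ ∀ p ∈ r.kept i, IsLucky m F p := by
    intro i hi
    induction i, hi using Nat.le_induction with
    | base =>
      obtain ⟨P, hmaj, hbatch, -, hP⟩ := r.exists_pool i₀
      exact step i₀ P hmaj hP (Finset.sdiff_subset.trans hbatch)
    | succ i hi ih =>
      obtain ⟨P, hmaj, -, hkept, hP⟩ := r.exists_pool (i + 1)
      -- `V` survives each deletion, so it secures the lucky majority in the next round as well.
      exact step (i + 1) P hmaj hP (ih.1.trans (hkept i rfl))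
  refine ⟨i₀, fun i hi => ⟨?_, (key i hi).2⟩⟩
  have := Finset.card_le_card (key i hi).1
  omega

theorem Execution.exists_passes (hm : ∀ a b : Fin n →₀ ℕ, a.degree < b.degree → a ≺[m] b)
    (hF : F.Finite) (hr : r.IsGeneric) : ∃ i G, r.Passes i G := by
  obtain ⟨M, hM⟩ := exists_coeff_bound (std_finite m (Ideal.span F))
  -- As every prime is at least `2`, the product exceeds the number of primes; this bound then
  -- forces `(N - 1) / 2` to be at least `M * M`.
  obtain ⟨i₀, hi₀⟩ := r.eventually_lucky hF hr (2 * (M * M) + 1)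
  have hbad : {p : ℕ | ¬ (p.Prime →
      (reduceMod p '' std m (Ideal.span F) = std m (modIdeal p F)) ∧
        ∀ e : ℕ, IsLucky (homOrder m)
          (homogenize '' F ∪ {(X none : MvPolynomial (Option (Fin n)) ℚ) ^ e}) p)}.Finite := by
    change ∀ᶠ p : ℕ in Filter.cofinite, _
    filter_upwards [eventually_leadingExponents_eq m hF,
      eventually_isLucky_union_X_pow m hm (hF.image homogenize)
        isHomogeneous_of_mem_homogenize] with p h1 h2 hp
    have : Fact p.Prime := ⟨hp⟩
    exact ⟨(reduceMod_image_std m (h1 hp).2.2 (h1 hp).2.1).2, h2 hp⟩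
  -- Discarding the finitely many bad primes and those tested before round `i₀` still leaves a test
  -- prime, which then belongs to a round from `i₀` on.
  obtain ⟨_, ⟨i, rfl⟩, hi⟩ := (hr.testPrimes.sdiff
    (hbad.union ((Set.finite_Iio i₀).image r.testPrime))).nonempty
  rw [Set.mem_union, not_or] at hi
  obtain ⟨himg, hlucky⟩ := not_not.mp hi.1 (r.testPrime_prime i)
  have hge : i₀ ≤ i := by
    by_contra! hlt
    exact hi.2 ⟨i, hlt, rfl⟩
  obtain ⟨hcard, hkept⟩ := hi₀ i hge
  have hprime : ∀ p ∈ r.kept i, p.Prime := fun p hp => by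
    obtain ⟨j, hj⟩ := r.exists_mem_batch hp
    exact r.batch_prime j p hj
  have hprod : 2 * (M * M) + 1 ≤ ∏ p ∈ r.kept i, p := by
    have h1 := Finset.pow_card_le_prod (r.kept i) (fun p => p) 2 fun p hp => (hprime p hp).two_le
    have h2 := Nat.lt_two_pow_self (n := (r.kept i).card)
    omega
  have hsqrt : M ≤ Nat.sqrt (((∏ p ∈ r.kept i, p) - 1) / 2) := by
    rw [Nat.le_sqrt]
    omega
  refine ⟨i, std m (Ideal.span F), isLift_std m hprime (fun p hp => ?_)
    (fun g hg b => ⟨(hM g hg b).1.trans hsqrt, (hM g hg b).2.trans hsqrt⟩), ?_⟩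
  · obtain ⟨j, hj⟩ := r.exists_mem_batch hp
    rw [r.symmStd_eq hj]
    by_contra hne
    exact hr.not_misleading j p hj
      ⟨hprime p hp, r.batch_integral j p hj, hkept p hp, hne⟩
  · have : Fact (r.testPrime i).Prime := ⟨r.testPrime_prime i⟩
    exact finalVerification_std himg (hlucky _)

theorem Execution.exists_returns (hm : ∀ a b : Fin n →₀ ℕ, a.degree < b.degree → a ≺[m] b)
    (hF : F.Finite) (hr : r.IsGeneric) : ∃ G, r.Returns G := by
  classical
  have h := r.exists_passes hm hF hr
  obtain ⟨G, hG⟩ := Nat.find_spec h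
  exact ⟨G, Nat.find h, hG, fun j hj G' hG' => Nat.find_min h hj ⟨G', hG'⟩⟩

end Algorithm

end SymGB

end

open SymGB in
theorem theorem4p2 {n : ℕ} (m : MonomialOrder (Fin n))
    (hm : ∀ a b : Fin n →₀ ℕ, a.degree < b.degree → a ≺[m] b)
    (σ : Equiv.Perm (Fin n)) (F : Finset (MvPolynomial (Fin n) ℚ))
    (hF : (Ideal.span (F : Set (MvPolynomial (Fin n) ℚ))).map (rename σ) =
      Ideal.span (F : Set (MvPolynomial (Fin n) ℚ))) :
    (∀ (r : Execution m σ (F : Set (MvPolynomial (Fin n) ℚ))) (G : Set (MvPolynomial (Fin n) ℚ)),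
      r.Returns G →
        IsReducedGroebnerBasis m G (Ideal.span (F : Set (MvPolynomial (Fin n) ℚ)))) ∧
    (∃ r : Execution m σ (F : Set (MvPolynomial (Fin n) ℚ)), r.IsGeneric) ∧
    (∀ r : Execution m σ (F : Set (MvPolynomial (Fin n) ℚ)), r.IsGeneric → ∃ G, r.Returns G) ∧
    {p : ℕ | IsMisleading m (F : Set (MvPolynomial (Fin n) ℚ)) p}.Finite ∧
    ((∀ f ∈ F, ∃ d : ℕ, f.IsHomogeneous d) →
      ∀ p : ℕ, ¬ IsMisleading m (F : Set (MvPolynomial (Fin n) ℚ)) p) := by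
  exact ⟨fun r _ h => r.isReducedGroebnerBasis_of_returns hm h,
    exists_generic_execution m σ F.finite_toSet,
    fun r hr => r.exists_returns hm F.finite_toSet hr,
    finite_isMisleading m F.finite_toSet,
    fun hhom => not_isMisleading_of_homogeneous m fun f hf => hhom f hf⟩
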